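/- Let $X\subseteq\mathbb R^n$ be a nonempty polyhedron (the solution set of finitely many linear inequalities) and let $\mathcal A\subset\mathbb R^n$ be nonempty and finite, such that the functions $e^{\alpha}(x)=\exp(\alpha^Tx)$, $\alpha\in\mathcal A$, are linearly independent on $X$. Signomials $\sum_{\alpha\in\mathcal A}c_\alpha e^{\alpha}$ are identified with their coefficient vectors $c\in\mathbb R^{\mathcal A}$. For $\beta\in\mathcal A$ let $$C_X(\mathcal A,\beta)=\Big\{c\in\mathbb R^{\mathcal A}: \sum_{\alpha\in\mathcal A} c_\alpha e^{\alpha}(x)\ge 0\ \ \forall x\in X,\ \ c_\alpha\ge 0\ \ \forall \alpha\neq\beta\Big\},\qquad C_X(\mathcal A)=\sum_{\beta\in\mathcal A}C_X(\mathcal A,\beta)$$ (Minkowski sum) be the $X$-AGE cones and the conditional SAGE cone. Write $\mathcal A\nu=\sum_{\alpha}\nu_\alpha\alpha$ for $\nu\in\mathbb R^{\mathcal A}$, $\sigma_X(y)=\sup_{x\in X}y^Tx$, and $N_\beta=\{\nu\in\mathbb R^{\mathcal A}:\nu_\alpha\ge 0\ \forall\alpha\ne\beta,\ \sum_\alpha\nu_\alpha=0\}$.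 A vector $\nu\in N_\beta$ is an $X$-circuit of $\mathcal A$ if $\nu\neq 0$, $\sigma_X(-\mathcal A\nu)<\infty$, and there are no linearly independent $\nu^{(1)},\nu^{(2)}\in N_\beta$ and $\theta\in(0,1)$ with $\nu=\theta\nu^{(1)}+(1-\theta)\nu^{(2)}$ such that $\mu\mapsto\sigma_X(-\mathcal A\mu)$ is finite and affine on the segment $[\nu^{(1)},\nu^{(2)}]$. It is normalized if $\nu_\beta=-1$. Let $\Lambda_X(\mathcal A)$ be the set of normalized $X$-circuits (over all $\beta\in\mathcal A$). For $\lambda\in\Lambda_X(\mathcal A)$ with $\lambda_\beta=-1$, the $\lambda$-witnessed AGE cone is $$C_X(\mathcal A,\lambda)=\Big\{c\in\mathbb R^{\mathcal A}:\ \prod_{\alpha:\,\lambda_\alpha>0}\Big(\frac{c_\alpha}{\lambda_\alpha}\Big)^{\lambda_\alpha}\ge -c_\beta\exp\big(\sigma_X(-\mathcal A\lambda)\big),\ \ c_\alpha\ge0\ \ \forall\alpha\ne\beta\Big\}.$$ Let $G_X(\mathcal A)\subseteq\mathbb R^{\mathcal A}\times\mathbb R$ be the convex cone generated by $(0,1)$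 and the vectors $\phi_\lambda=(\lambda,\sigma_X(-\mathcal A\lambda))$, $\lambda\in\Lambda_X(\mathcal A)$, and let $\Lambda_X^\star(\mathcal A)$ be the set of those $\lambda\in\Lambda_X(\mathcal A)$ for which $\phi_\lambda$ generates an extreme ray of $G_X(\mathcal A)$ (the normalized reduced $X$-circuits). Theorem. If $\Lambda_X(\mathcal A)$ is nonempty, then $\Lambda_X^\star(\mathcal A)$ is finite and $$C_X(\mathcal A)=\sum_{\lambda\in\Lambda_X^\star(\mathcal A)}C_X(\mathcal A,\lambda).$$ Moreover, there is no proper subset $\Lambda\subsetneq\Lambda_X^\star(\mathcal A)$ for which $C_X(\mathcal A)=\sum_{\lambda\in\Lambda}C_X(\mathcal A,\lambda)$ (the sum over the empty set being $\{0\}$). -/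

import Mathlib

open scoped Pointwise

noncomputable section

namespace ConditionalSAGE

variable {n : ℕ}

/-- A polyhedron in `ℝⁿ`: the solution set of finitely many non-strict linear inequalities. -/
def IsPolyhedron (X : Set (Fin n → ℝ)) : Prop :=
  ∃ (m : ℕ) (M : Matrix (Fin m) (Fin n) ℝ) (b : Fin m → ℝ), X = {x | M.mulVec x ≤ b}

/-- `e^α (x) = exp (αᵀ x)`. -/
def expMonomial (α x : Fin n → ℝ) : ℝ := Real.exp (dotProduct α x)

/-- The functions `e^α`, `α ∈ A`, restricted to `X`, are linearly independent. -/
def ExpLinIndepOn (A : Finset (Fin n → ℝ)) (X : Set (Fin n → ℝ)) : Prop :=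
  LinearIndependent ℝ (fun (α : A) (x : X) => expMonomial (α : Fin n → ℝ) (x : Fin n → ℝ))

/-- The signomial `∑ c_α e^α` with coefficient vector `c ∈ ℝ^A`. -/
def signomial (A : Finset (Fin n → ℝ)) (c : A → ℝ) (x : Fin n → ℝ) : ℝ :=
  ∑ α : A, c α * expMonomial (α : Fin n → ℝ) x

/-- The linear operator `ν ↦ A ν = ∑ ν_α α` from `ℝ^A` to `ℝⁿ`. -/
def expMap (A : Finset (Fin n → ℝ)) (ν : A → ℝ) : Fin n → ℝ :=
  ∑ α : A, ν α • (α : Fin n → ℝ)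

/-- The set `{yᵀ x : x ∈ X}`, whose supremum is the value of the support function of `X` at `y`. -/
def supportValues (X : Set (Fin n → ℝ)) (y : Fin n → ℝ) : Set ℝ :=
  (fun x => dotProduct y x) '' X

/-- `σ_X(-Aν) < ∞`. -/
def SuppFinite (A : Finset (Fin n → ℝ)) (X : Set (Fin n → ℝ)) (ν : A → ℝ) : Prop :=
  BddAbove (supportValues X (-expMap A ν))

/-- `σ_X(-Aν) = sup {(-Aν)ᵀ x : x ∈ X}`. As a real supremum it is meaningful (and used) only for
nonempty `X` and `ν` with `SuppFinite A X ν`. -/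
def suppVal (A : Finset (Fin n → ℝ)) (X : Set (Fin n → ℝ)) (ν : A → ℝ) : ℝ :=
  sSup (supportValues X (-expMap A ν))

/-- The `X`-AGE cone `C_X(A, β)`, as a cone of coefficient vectors. -/
def ageCone (A : Finset (Fin n → ℝ)) (X : Set (Fin n → ℝ)) (β : A) : Set (A → ℝ) :=
  {c | (∀ α, α ≠ β → 0 ≤ c α) ∧ ∀ x ∈ X, 0 ≤ signomial A c x}

/-- The conditional SAGE cone `C_X(A)`: the Minkowski sum of the `X`-AGE cones. -/
def sageCone (A : Finset (Fin n → ℝ)) (X : Set (Fin n → ℝ)) : Set (A → ℝ) :=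
  ∑ β : A, ageCone A X β

/-- `N_β`: vectors with coordinate sum zero that are nonnegative away from `β`. -/
def sumZeroCone (A : Finset (Fin n → ℝ)) (β : A) : Set (A → ℝ) :=
  {ν | (∀ α, α ≠ β → 0 ≤ ν α) ∧ ∑ α, ν α = 0}

/-- `ν ↦ σ_X(-Aν)` is finite and linear (that is, affine) on the segment `[ν₁, ν₂]`.
Finiteness at the endpoints gives finiteness on the segment. -/
def SuppLinearOn (A : Finset (Fin n → ℝ)) (X : Set (Fin n → ℝ)) (ν₁ ν₂ : A → ℝ) : Prop :=
  SuppFinite A X ν₁ ∧ SuppFinite A X ν₂ ∧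
    ∀ t ∈ Set.Icc (0 : ℝ) 1,
      suppVal A X ((1 - t) • ν₁ + t • ν₂) = (1 - t) * suppVal A X ν₁ + t * suppVal A X ν₂

/-- `ν ∈ N_β` is an `X`-circuit of `A`: it is nonzero, `σ_X(-Aν) < ∞`, and it is not a (proper)
convex combination of two non-proportional elements of `N_β` on whose segment `σ_X(-A ·)` is
linear. -/
def IsCircuitAt (A : Finset (Fin n → ℝ)) (X : Set (Fin n → ℝ)) (β : A) (ν : A → ℝ) : Prop :=
  ν ∈ sumZeroCone A β ∧ ν ≠ 0 ∧ SuppFinite A X ν ∧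
    ¬ ∃ ν₁ ∈ sumZeroCone A β, ∃ ν₂ ∈ sumZeroCone A β,
      LinearIndependent ℝ ![ν₁, ν₂] ∧ ν ∈ openSegment ℝ ν₁ ν₂ ∧ SuppLinearOn A X ν₁ ν₂

/-- `Λ_X(A)`: all normalized `X`-circuits of `A`. -/
def normalizedCircuits (A : Finset (Fin n → ℝ)) (X : Set (Fin n → ℝ)) : Set (A → ℝ) :=
  {lam | ∃ β, IsCircuitAt A X β lam ∧ lam β = -1}

/-- The `λ`-witnessed AGE cone `C_X(A, λ)`, for a normalized vector `λ ∈ N_β` (`λ_β = -1`); the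
index `β` is determined by `λ`, as all other coordinates of `λ` are nonnegative. -/
def witnessedCone (A : Finset (Fin n → ℝ)) (X : Set (Fin n → ℝ)) (lam : A → ℝ) : Set (A → ℝ) :=
  {c | ∃ β, lam ∈ sumZeroCone A β ∧ lam β = -1 ∧ (∀ α, α ≠ β → 0 ≤ c α) ∧
    -c β * Real.exp (suppVal A X lam) ≤
      ∏ α : A with 0 < lam α, (c α / lam α) ^ (lam α)}

/-- The functional form `φ_ν = (ν, σ_X(-Aν)) ∈ ℝ^A × ℝ`. -/
def functionalForm (A : Finset (Fin n → ℝ)) (X : Set (Fin n → ℝ)) (ν : A → ℝ) : (A → ℝ) × ℝ :=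
  (ν, suppVal A X ν)

/-- The circuit graph `G_X(A)`: the convex cone generated by the functional forms of the normalized
`X`-circuits together with `(0, 1)`. -/
def circuitGraph (A : Finset (Fin n → ℝ)) (X : Set (Fin n → ℝ)) :
    PointedCone ℝ ((A → ℝ) × ℝ) :=
  PointedCone.hull ℝ (functionalForm A X '' normalizedCircuits A X ∪ {(0, 1)})

/-- `v` generates an extreme ray of the cone `K`: it is nonzero and the ray `ℝ₊ v` is a face. -/
def GeneratesExtremeRay {E : Type*} [AddCommGroup E] [Module ℝ E] (K : PointedCone ℝ E) (v : E) :
    Prop :=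
  v ≠ 0 ∧ (PointedCone.hull ℝ {v}).IsFaceOf K

/-- `Λ*_X(A)`: the normalized reduced `X`-circuits of `A`. -/
def reducedCircuits (A : Finset (Fin n → ℝ)) (X : Set (Fin n → ℝ)) : Set (A → ℝ) :=
  {lam | lam ∈ normalizedCircuits A X ∧
    GeneratesExtremeRay (circuitGraph A X) (functionalForm A X lam)}

end ConditionalSAGE

end

/-!
Signomial coefficient vectors `c ∈ ℝ^A` are tested against positive vectors `v ∈ ℝ^A`. Writing
`w = log v` and `L_w(ν, τ) = ∑ ν_α w_α + τ` (`logForm`), weighted AM-GM shows that `v` is in the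
dual of the `λ`-witnessed cone exactly when `L_w(φ_λ) ≥ 0` (`pairing_nonneg`,
`exists_mem_witnessedCone`). Generation by witnessed cones thus becomes a question about the
polyhedral cones `epiCone A X β`, the epigraphs of `ν ↦ σ_X(-Aν)` over `N_β`.

* By Farkas' lemma for the polyhedron `X`, each epigraph is a linear image of a slice of a finitely
  generated cone, so it is finitely generated (`epiCone_fg`); and if `L_w` is nonnegative on it,
  some `x ∈ X` satisfies `αᵀx - βᵀx ≤ w_α - w_β` for all `α` (`exists_mem_of_logForm_nonneg`).
  Such an `x` makes `v` dominate a multiple of the evaluation at `x`, with equality at `β`, so `v`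
  is nonnegative on the `β`-th AGE cone.
* By linear independence, finitely many points of `X` separate signomials. The sum of the
  evaluations there is positive on the SAGE cone away from `0`, and the form `L_w` of its logarithm
  is positive on the epigraphs away from `0` (`exists_pos_functional`, `logForm_pos`). So these
  cones are pointed, and a minimal generating set of each of them consists of extreme rays
  (`exists_extreme_generators`).
* Extreme rays of the epigraphs are vertical or spanned by a normalized circuit
  (`extreme_ray_epiCone`). So the circuit graph is finitely generated and contains all epigraphs
  (`circuitGraph_fg`), and it is generated by `(0, 1)` and the reduced circuits
  (`circuitGraph_eq_hull_reduced`).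

The sum of the witnessed cones of the reduced circuits is closed. A point of an AGE cone outside of
it would be separated from it by some `v`, which can be taken positive; then `L_w ≥ 0` on the
reduced circuits, hence on all epigraphs, so `v` is nonnegative on the AGE cone, a contradiction
(`ageCone_subset_sum_witnessedCone`). Conversely, for a reduced circuit `λ` the extreme ray through
`φ_λ` is not generated by the other reduced circuits and `(0, 1)`, and Farkas' lemma yields a form
`L_w` that is negative at `φ_λ` and nonnegative at the other reduced circuits, so the cone of `λ` is not redundant
(`sageCone_ne_sum_of_notMem`).
-/

namespace ConditionalSAGE

/-! ### Finitely generated cones: Farkas' lemma, elimination, extreme rays -/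

section Cones

variable {E F : Type*} [AddCommGroup E] [Module ℝ E] [AddCommGroup F] [Module ℝ F]

theorem mem_hull_singleton {v x : E} :
    x ∈ PointedCone.hull ℝ {v} ↔ ∃ r : ℝ, 0 ≤ r ∧ x = r • v := by
  rw [Submodule.mem_span_singleton]
  constructor
  · rintro ⟨r, rfl⟩
    exact ⟨r, r.2, rfl⟩
  · rintro ⟨r, hr, rfl⟩
    exact ⟨⟨r, hr⟩, rfl⟩

@[elab_as_elim]
theorem hull_induction {S : Set E} {p : (x : E) → x ∈ PointedCone.hull ℝ S → Prop}
    (mem : ∀ s (hs : s ∈ S), p s (Submodule.subset_span hs)) (zero : p 0 (zero_mem _))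
    (add : ∀ x y hx hy, p x hx → p y hy → p (x + y) (add_mem hx hy))
    (smul : ∀ (r : ℝ) (x : E) (hr : 0 ≤ r) (hx : x ∈ PointedCone.hull ℝ S), p x hx →
      p (r • x) (PointedCone.smul_mem _ hr hx)) {x : E} (hx : x ∈ PointedCone.hull ℝ S) :
    p x hx := by
  induction hx using Submodule.span_induction with
  | mem x hx => exact mem x hx
  | zero => exact zero
  | add x y hx hy ihx ihy => exact add x y hx hy ihx ihy
  | smul r x hx ih => exact smul r x r.2 hx ih

theorem nonneg_of_mem_hull {S : Set E} (f : E →ₗ[ℝ] ℝ) (hf : ∀ s ∈ S, 0 ≤ f s) {x : E}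
    (hx : x ∈ PointedCone.hull ℝ S) : 0 ≤ f x := by
  induction hx using hull_induction with
  | mem x hx => exact hf x hx
  | zero => simp
  | add x y _ _ hx hy => rw [map_add]; exact add_nonneg hx hy
  | smul r x hr _ hx => rw [map_smul]; exact mul_nonneg hr hx

theorem exists_of_mem_hull_image {S : Set E} (φ : E →ₗ[ℝ] F) {y : F}
    (hy : y ∈ PointedCone.hull ℝ (φ '' S)) : ∃ x ∈ PointedCone.hull ℝ S, φ x = y := by
  induction hy using hull_induction with
  | mem y hy =>
    obtain ⟨x, hx, rfl⟩ := hy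
    exact ⟨x, Submodule.subset_span hx, rfl⟩
  | zero => exact ⟨0, zero_mem _, map_zero _⟩
  | add _ _ _ _ hx hy =>
    obtain ⟨x, hx, rfl⟩ := hx
    obtain ⟨y, hy, rfl⟩ := hy
    exact ⟨x + y, add_mem hx hy, map_add _ _ _⟩
  | smul r _ hr _ hx =>
    obtain ⟨x, hx, rfl⟩ := hx
    exact ⟨r • x, PointedCone.smul_mem _ hr hx, map_smul _ _ _⟩

/-- Farkas' lemma for finitely generated cones, by induction on the number of generators: a
functional that separates `x` from all generators but `a`, and is negative at `a`, is corrected by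
projecting along `a` onto its kernel. -/
theorem exists_separating_functional (T : Finset E) (x : E)
    (hx : x ∉ PointedCone.hull ℝ (T : Set E)) :
    ∃ f : E →ₗ[ℝ] ℝ, (∀ t ∈ T, 0 ≤ f t) ∧ f x < 0 := by
  classical
  induction hk : T.card using Nat.strong_induction_on generalizing T x with
  | _ k ih =>
  rcases T.eq_empty_or_nonempty with rfl | ⟨a, ha⟩
  · have hx0 : x ≠ 0 := by
      rintro rfl
      exact hx (zero_mem _)
    obtain ⟨f, hf⟩ := not_forall.mp (mt (Module.forall_dual_apply_eq_zero_iff ℝ x).mp hx0)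
    rcases lt_or_gt_of_ne hf with h | h
    · exact ⟨f, by simp, h⟩
    · exact ⟨-f, by simp, by simpa using h⟩
  · have hcard : (T.erase a).card < k := hk ▸ Finset.card_erase_lt_of_mem ha
    have hxS : x ∉ PointedCone.hull ℝ (T.erase a : Set E) := fun h =>
      hx (Submodule.span_mono (by simp) h)
    obtain ⟨f, hfS, hfx⟩ := ih _ hcard _ x hxS rfl
    by_cases hfa : 0 ≤ f a
    · refine ⟨f, fun t ht => ?_, hfx⟩
      by_cases hta : t = a
      · rwa [hta]
      · exact hfS t (Finset.mem_erase.mpr ⟨hta, ht⟩)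
    push Not at hfa
    let π : E →ₗ[ℝ] E := LinearMap.id - f.smulRight ((f a)⁻¹ • a)
    have hπ (y : E) : π y = y - (f y / f a) • a := by
      simp [π, smul_smul, div_eq_mul_inv]
    have hπa : π a = 0 := by rw [hπ, div_self hfa.ne, one_smul, sub_self]
    have haC : a ∈ PointedCone.hull ℝ (T : Set E) := Submodule.subset_span ha
    have hle : PointedCone.hull ℝ (((T.erase a).image π : Finset E) : Set E) ≤
        PointedCone.hull ℝ (T : Set E) := by
      refine Submodule.span_le.mpr fun y hy => ?_
      obtain ⟨s, hs, rfl⟩ := Finset.mem_image.mp (Finset.mem_coe.mp hy)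
      rw [hπ, sub_eq_add_neg, ← neg_smul]
      refine add_mem (Submodule.subset_span (Finset.mem_of_mem_erase hs))
        (PointedCone.smul_mem _ ?_ haC)
      rw [neg_nonneg]
      exact div_nonpos_of_nonneg_of_nonpos (hfS s hs) hfa.le
    have hπx : π x ∉ PointedCone.hull ℝ (((T.erase a).image π : Finset E) : Set E) := by
      intro h
      apply hx
      have hxe : x = π x + (f x / f a) • a := by rw [hπ]; abel
      rw [hxe]
      exact add_mem (hle h)
        (PointedCone.smul_mem _ (div_nonneg_of_nonpos hfx.le hfa.le) haC)
    obtain ⟨g, hg, hgx⟩ := ih _ (Finset.card_image_le.trans_lt hcard) _ (π x) hπx rfl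
    refine ⟨g.comp π, fun t ht => ?_, hgx⟩
    by_cases hta : t = a
    · rw [hta, LinearMap.comp_apply, hπa, map_zero]
    · exact hg _ (Finset.mem_image_of_mem _ (Finset.mem_erase.mpr ⟨hta, ht⟩))

/-- One step of Fourier–Motzkin elimination: the intersection of a finitely generated cone with a
half-space is finitely generated, by the generators in the half-space and by the points
`f p • q - f q • p` of the bounding hyperplane, for generators `p` and `q` on opposite sides. -/
theorem fg_inf_halfspace {C : PointedCone ℝ E} (hC : C.FG) (f : E →ₗ[ℝ] ℝ) :
    ∃ D : PointedCone ℝ E, D.FG ∧ ∀ x, x ∈ D ↔ x ∈ C ∧ 0 ≤ f x := by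
  classical
  obtain ⟨S, rfl⟩ := hC
  let P : Finset E := S.filter fun s => 0 ≤ f s
  let Q : Finset E := S.filter fun s => f s < 0
  let R : Finset E := (P ×ˢ Q).image fun z => f z.1 • z.2 - f z.2 • z.1
  have hS : (S : Set E) = (P : Set E) ∪ (Q : Set E) := by
    rw [← Finset.coe_union, Finset.coe_inj]
    ext s
    simp only [P, Q, Finset.mem_union, Finset.mem_filter]
    have := le_or_gt 0 (f s)
    tauto
  set D : PointedCone ℝ E := PointedCone.hull ℝ ((P ∪ R : Finset E) : Set E)
  have hP : ∀ x ∈ PointedCone.hull ℝ (P : Set E), x ∈ D := fun x hx =>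
    Submodule.span_mono (by simp) hx
  have hQf : ∀ x ∈ PointedCone.hull ℝ (Q : Set E), x = 0 ∨ f x < 0 := by
    intro x hx
    induction hx using hull_induction with
    | mem x hx => exact Or.inr (Finset.mem_filter.mp hx).2
    | zero => exact Or.inl rfl
    | add x y _ _ hx hy =>
      rcases hx with rfl | hx <;> rcases hy with rfl | hy
      · exact Or.inl (add_zero _)
      · exact Or.inr (by simpa using hy)
      · exact Or.inr (by simpa using hx)
      · exact Or.inr (by rw [map_add]; linarith)
    | smul r x hr _ hx =>
      rcases hx with rfl | hx
      · exact Or.inl (smul_zero _)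
      · rcases hr.eq_or_lt with rfl | hr
        · exact Or.inl (zero_smul _ _)
        · exact Or.inr (by rw [map_smul]; exact mul_neg_of_pos_of_neg hr hx)
  have hPQ : ∀ p ∈ PointedCone.hull ℝ (P : Set E), ∀ q ∈ PointedCone.hull ℝ (Q : Set E),
      f p • q - f q • p ∈ D := by
    intro p hp q hq
    induction hp using hull_induction with
    | zero => simp
    | add x y _ _ hx hy =>
      have : f (x + y) • q - f q • (x + y) = (f x • q - f q • x) + (f y • q - f q • y) := by
        rw [map_add]; module
      rw [this]
      exact add_mem hx hy
    | smul r x hr _ hx =>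
      have : f (r • x) • q - f q • (r • x) = r • (f x • q - f q • x) := by
        rw [map_smul, smul_eq_mul]; module
      rw [this]
      exact PointedCone.smul_mem _ hr hx
    | mem p hp =>
      induction hq using hull_induction with
      | zero => simp
      | add x y _ _ hx hy =>
        have : f p • (x + y) - f (x + y) • p = (f p • x - f x • p) + (f p • y - f y • p) := by
          rw [map_add]; module
        rw [this]
        exact add_mem hx hy
      | smul r x hr _ hx =>
        have : f p • (r • x) - f (r • x) • p = r • (f p • x - f x • p) := by
          rw [map_smul, smul_eq_mul]; module
        rw [this]
        exact PointedCone.smul_mem _ hr hx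
      | mem q hq =>
        refine Submodule.subset_span ?_
        rw [Finset.coe_union]
        exact Or.inr (Finset.mem_coe.mpr (Finset.mem_image.mpr
          ⟨(p, q), Finset.mem_product.mpr ⟨hp, hq⟩, rfl⟩))
  refine ⟨D, ⟨_, rfl⟩, fun x => ⟨fun hx => ?_, fun hx => ?_⟩⟩
  · refine ⟨?_, nonneg_of_mem_hull f ?_ hx⟩
    · refine Submodule.span_le.mpr (fun y hy => ?_) hx
      rcases Finset.mem_union.mp (Finset.mem_coe.mp hy) with hy | hy
      · exact Submodule.subset_span (Finset.mem_filter.mp hy).1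
      · obtain ⟨z, hz, rfl⟩ := Finset.mem_image.mp hy
        obtain ⟨hz1, hz2⟩ := Finset.mem_product.mp hz
        obtain ⟨h1, h1'⟩ := Finset.mem_filter.mp hz1
        obtain ⟨h2, h2'⟩ := Finset.mem_filter.mp hz2
        rw [sub_eq_add_neg, ← neg_smul]
        exact add_mem (PointedCone.smul_mem _ h1' (Submodule.subset_span h2))
          (PointedCone.smul_mem _ (neg_nonneg.mpr h2'.le) (Submodule.subset_span h1))
    · intro y hy
      rcases Finset.mem_union.mp (Finset.mem_coe.mp hy) with hy | hy
      · exact (Finset.mem_filter.mp hy).2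
      · obtain ⟨z, -, rfl⟩ := Finset.mem_image.mp hy
        simp [mul_comm]
  · obtain ⟨hx, hfx⟩ := hx
    rw [hS, Submodule.span_union, Submodule.mem_sup] at hx
    obtain ⟨p, hp, q, hq, rfl⟩ := hx
    rw [map_add] at hfx
    rcases hQf q hq with rfl | hq0
    · rw [add_zero]
      exact hP p hp
    · have hp0 : 0 < f p := by linarith
      have : p + q = ((f p + f q) / f p) • p + (f p)⁻¹ • (f p • q - f q • p) := by
        rw [smul_sub, smul_smul, smul_smul, inv_mul_cancel₀ hp0.ne', add_div, div_self hp0.ne',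
          div_eq_inv_mul]
        module
      rw [this]
      exact add_mem (PointedCone.smul_mem _ (div_nonneg hfx hp0.le) (hP p hp))
        (PointedCone.smul_mem _ (inv_nonneg.mpr hp0.le) (hPQ p hp q hq))

theorem fg_inf_ker {ι : Type*} [Finite ι] {C : PointedCone ℝ E} (hC : C.FG)
    (f : E →ₗ[ℝ] (ι → ℝ)) :
    ∃ D : PointedCone ℝ E, D.FG ∧ ∀ x, x ∈ D ↔ x ∈ C ∧ f x = 0 := by
  classical
  cases nonempty_fintype ι
  have h : ∀ s : Finset ι, ∃ D : PointedCone ℝ E, D.FG ∧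
      ∀ x, x ∈ D ↔ x ∈ C ∧ ∀ i ∈ s, f x i = 0 := by
    intro s
    induction s using Finset.induction_on with
    | empty => exact ⟨C, hC, by simp⟩
    | insert i s _ ih =>
      obtain ⟨D, hD, hmem⟩ := ih
      obtain ⟨D₁, hD₁, hmem₁⟩ := fg_inf_halfspace hD (LinearMap.proj i ∘ₗ f)
      obtain ⟨D₂, hD₂, hmem₂⟩ := fg_inf_halfspace hD₁ (-(LinearMap.proj i ∘ₗ f))
      refine ⟨D₂, hD₂, fun x => ?_⟩
      rw [hmem₂, hmem₁, hmem, Finset.forall_mem_insert]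
      simp only [LinearMap.comp_apply, LinearMap.proj_apply, LinearMap.neg_apply, neg_nonneg]
      constructor
      · rintro ⟨⟨⟨h1, h2⟩, h3⟩, h4⟩
        exact ⟨h1, le_antisymm h4 h3, h2⟩
      · rintro ⟨h1, h2, h3⟩
        exact ⟨⟨⟨h1, h3⟩, h2.ge⟩, h2.le⟩
  obtain ⟨D, hD, hmem⟩ := h Finset.univ
  exact ⟨D, hD, fun x => by rw [hmem, funext_iff]; simp⟩

/-- If the ray through `v` is a face of a cone and `v` is a conic combination of points of the
cone, then one of these points generates the ray. -/
theorem exists_mem_ray_of_mem_hull {K : PointedCone ℝ E} {v : E} (hv : GeneratesExtremeRay K v)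
    {S : Set E} (hSK : S ⊆ K) (hvS : v ∈ PointedCone.hull ℝ S) :
    ∃ s ∈ S, ∃ r : ℝ, 0 < r ∧ s = r • v := by
  obtain ⟨hv0, hF⟩ := hv
  have hK : PointedCone.hull ℝ S ≤ K := Submodule.span_le.mpr hSK
  have key : ∀ x ∈ PointedCone.hull ℝ S, x ∈ PointedCone.hull ℝ {v} →
      x ∈ PointedCone.hull ℝ (S ∩ PointedCone.hull ℝ {v}) := by
    intro x hx
    induction hx using hull_induction with
    | mem x hx => exact fun h => Submodule.subset_span ⟨hx, h⟩
    | zero => exact fun _ => zero_mem _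
    | add x y hx hy ihx ihy =>
      exact fun h => add_mem (ihx (hF.mem_of_add_mem_left (hK hx) (hK hy) h))
        (ihy (hF.mem_of_add_mem_right (hK hx) (hK hy) h))
    | smul r x hr hx ih =>
      intro h
      rcases hr.eq_or_lt with rfl | hr
      · simp
      · refine PointedCone.smul_mem _ hr.le (ih ?_)
        have := PointedCone.smul_mem _ (inv_nonneg.mpr hr.le) h
        rwa [smul_smul, inv_mul_cancel₀ hr.ne', one_smul] at this
  by_contra hcon
  have hle : PointedCone.hull ℝ (S ∩ PointedCone.hull ℝ {v}) ≤ ⊥ := by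
    refine Submodule.span_le.mpr ?_
    rintro s ⟨hs, hsv⟩
    obtain ⟨r, hr, rfl⟩ := mem_hull_singleton.mp hsv
    rcases hr.eq_or_lt with rfl | hr
    · simp
    · exact absurd ⟨_, hs, r, hr, rfl⟩ hcon
  exact hv0 (by simpa using hle (key v hvS (Submodule.subset_span rfl)))

/-- A finite generating set of a cone on which some functional is positive contains a generating
set of extreme rays, namely any minimal generating subset. -/
theorem exists_extreme_generators (T : Finset E) (f : E →ₗ[ℝ] ℝ) (hf : ∀ t ∈ T, 0 < f t) :
    ∃ S ⊆ T, PointedCone.hull ℝ (S : Set E) = PointedCone.hull ℝ (T : Set E) ∧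
      ∀ s ∈ S, GeneratesExtremeRay (PointedCone.hull ℝ (T : Set E)) s := by
  classical
  obtain ⟨S, hS, hmin⟩ := Finset.exists_min_image
    (T.powerset.filter fun S : Finset E => PointedCone.hull ℝ (S : Set E) = PointedCone.hull ℝ (T : Set E))
    Finset.card ⟨T, by simp⟩
  obtain ⟨hST, hgen⟩ := Finset.mem_filter.mp hS
  rw [Finset.mem_powerset] at hST
  refine ⟨S, hST, hgen, fun s hs => ⟨?_, ?_⟩⟩
  · rintro rfl
    simpa using hf 0 (hST hs)
  -- `s` is not redundant
  have hred : s ∉ PointedCone.hull ℝ (S.erase s : Set E) := by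
    intro h
    have : PointedCone.hull ℝ (S.erase s : Set E) = PointedCone.hull ℝ (T : Set E) := by
      rw [← hgen]
      refine le_antisymm (Submodule.span_mono (by simp)) (Submodule.span_le.mpr fun t ht => ?_)
      by_cases hts : t = s
      · rwa [hts]
      · exact Submodule.subset_span (Finset.mem_coe.mpr (Finset.mem_erase.mpr ⟨hts, ht⟩))
    have h1 := hmin (S.erase s) (Finset.mem_filter.mpr
      ⟨Finset.mem_powerset.mpr ((Finset.erase_subset _ _).trans hST), this⟩)
    exact absurd (Finset.card_erase_lt_of_mem hs) (not_lt.mpr h1)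
  have hdecomp : ∀ x ∈ PointedCone.hull ℝ (T : Set E), ∃ a : ℝ, 0 ≤ a ∧
      ∃ z ∈ PointedCone.hull ℝ (S.erase s : Set E), x = a • s + z := by
    intro x hx
    rw [← hgen, ← Finset.insert_erase hs, Finset.coe_insert, Submodule.mem_span_insert] at hx
    obtain ⟨a, z, hz, rfl⟩ := hx
    exact ⟨a, a.2, z, by simpa using hz, rfl⟩
  have hpos : ∀ z ∈ PointedCone.hull ℝ (S.erase s : Set E), 0 ≤ f z ∧ (f z = 0 → z = 0) := by
    intro z hz
    induction hz using hull_induction with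
    | mem z hz =>
      have := hf z (hST (Finset.mem_of_mem_erase (Finset.mem_coe.mp hz)))
      exact ⟨this.le, fun h => absurd h this.ne'⟩
    | zero => simp
    | add x y _ _ hx hy =>
      rw [map_add]
      refine ⟨add_nonneg hx.1 hy.1, fun h => ?_⟩
      rw [hx.2 (by linarith [hx.1, hy.1]), hy.2 (by linarith [hx.1, hy.1]), add_zero]
    | smul r x hr _ hx =>
      rw [map_smul, smul_eq_mul]
      refine ⟨mul_nonneg hr hx.1, fun h => ?_⟩
      rcases mul_eq_zero.mp h with h | h
      · rw [h, zero_smul]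
      · rw [hx.2 h, smul_zero]
  refine PointedCone.IsFaceOf.of_mem_of_add_mem_left ?_ ?_
  · rw [← hgen]
    exact Submodule.span_mono (by simpa using hs)
  · intro x y hx hy hxy
    obtain ⟨a, ha, z, hz, rfl⟩ := hdecomp x hx
    obtain ⟨b, hb, w, hw, rfl⟩ := hdecomp y hy
    obtain ⟨r, hr, hr'⟩ := mem_hull_singleton.mp hxy
    have hzw : z + w = (r - a - b) • s := by
      rw [sub_smul, sub_smul, ← hr']; abel
    have hle : r - a - b ≤ 0 := by
      by_contra! hlt
      apply hred
      have := PointedCone.smul_mem _ (inv_nonneg.mpr hlt.le) (add_mem hz hw)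
      rwa [hzw, smul_smul, inv_mul_cancel₀ hlt.ne', one_smul] at this
    have h1 : f (z + w) ≤ 0 := by
      rw [hzw, map_smul, smul_eq_mul]
      exact mul_nonpos_of_nonpos_of_nonneg hle (hf s (hST hs)).le
    rw [map_add] at h1
    have hz0 : z = 0 := (hpos z hz).2 (by linarith [(hpos z hz).1, (hpos w hw).1])
    rw [hz0, add_zero]
    exact mem_hull_singleton.mpr ⟨a, ha, rfl⟩

end Cones

/-! ### The epigraph of the support function over `N_β` -/

section Epigraph

variable {n : ℕ} {A : Finset (Fin n → ℝ)} {X : Set (Fin n → ℝ)} {β : A}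

theorem expMap_dotProduct (ν : A → ℝ) (x : Fin n → ℝ) :
    expMap A ν ⬝ᵥ x = ∑ α : A, ν α * ((α : Fin n → ℝ) ⬝ᵥ x) := by
  simp only [expMap, sum_dotProduct, smul_dotProduct, smul_eq_mul]

/-- The linear form `(ν, τ) ↦ ∑ ν_α w_α + τ` on `ℝ^A × ℝ`. -/
def logForm (w : A → ℝ) : (A → ℝ) × ℝ →ₗ[ℝ] ℝ where
  toFun p := ∑ α, p.1 α * w α + p.2
  map_add' p q := by
    simp only [Prod.fst_add, Prod.snd_add, Pi.add_apply, add_mul, Finset.sum_add_distrib]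
    ring
  map_smul' r p := by
    simp only [Prod.smul_fst, Prod.smul_snd, Pi.smul_apply, smul_eq_mul, RingHom.id_apply, mul_add,
      Finset.mul_sum, mul_assoc]

theorem logForm_apply (w : A → ℝ) (p : (A → ℝ) × ℝ) :
    logForm w p = ∑ α, p.1 α * w α + p.2 := rfl

theorem logForm_mono {ν : A → ℝ} (hν : ν ∈ sumZeroCone A β) {u w : A → ℝ}
    (h : ∀ α, u α - u β ≤ w α - w β) : ∑ α, ν α * u α ≤ ∑ α, ν α * w α := by
  have key (v : A → ℝ) : ∑ α, ν α * v α = ∑ α, ν α * (v α - v β) := by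
    simp only [mul_sub, Finset.sum_sub_distrib, ← Finset.sum_mul, hν.2, zero_mul, sub_zero]
  rw [key u, key w]
  refine Finset.sum_le_sum fun α _ => ?_
  by_cases hα : α = β
  · simp [hα]
  · exact mul_le_mul_of_nonneg_left (h α) (hν.1 α hα)

theorem sumZeroCone_add {ν μ : A → ℝ} (hν : ν ∈ sumZeroCone A β) (hμ : μ ∈ sumZeroCone A β) :
    ν + μ ∈ sumZeroCone A β :=
  ⟨fun α hα => add_nonneg (hν.1 α hα) (hμ.1 α hα), by
    simp only [Pi.add_apply, Finset.sum_add_distrib, hν.2, hμ.2, add_zero]⟩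

theorem sumZeroCone_smul {ν : A → ℝ} (hν : ν ∈ sumZeroCone A β) {r : ℝ} (hr : 0 ≤ r) :
    r • ν ∈ sumZeroCone A β :=
  ⟨fun α hα => mul_nonneg hr (hν.1 α hα), by
    simp only [Pi.smul_apply, smul_eq_mul, ← Finset.mul_sum, hν.2, mul_zero]⟩

variable (A X β) in
/-- The epigraph of `ν ↦ σ_X(-Aν)` over `N_β`. The condition `σ_X(-Aν) ≤ τ` is spelled out
pointwise, so that no supremum of an unbounded set occurs. -/
def epiCone : PointedCone ℝ ((A → ℝ) × ℝ) :=
  PointedCone.ofConeComb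
    {p | p.1 ∈ sumZeroCone A β ∧ ∀ x ∈ X, 0 ≤ logForm (fun α : A => (α : Fin n → ℝ) ⬝ᵥ x) p}
    ⟨0, ⟨fun _ _ => le_rfl, by simp⟩, fun x _ => by simp⟩
    (fun p hp q hq a ha b hb =>
      ⟨sumZeroCone_add (sumZeroCone_smul hp.1 ha) (sumZeroCone_smul hq.1 hb), fun x hx => by
        rw [map_add, map_smul, map_smul, smul_eq_mul, smul_eq_mul]
        exact add_nonneg (mul_nonneg ha (hp.2 x hx)) (mul_nonneg hb (hq.2 x hx))⟩)

theorem mem_epiCone {p : (A → ℝ) × ℝ} : p ∈ epiCone A X β ↔ p.1 ∈ sumZeroCone A β ∧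
    ∀ x ∈ X, 0 ≤ logForm (fun α : A => (α : Fin n → ℝ) ⬝ᵥ x) p := Iff.rfl

theorem mem_epiCone_iff_suppVal_le (hX : X.Nonempty) {p : (A → ℝ) × ℝ} :
    p ∈ epiCone A X β ↔ p.1 ∈ sumZeroCone A β ∧ SuppFinite A X p.1 ∧ suppVal A X p.1 ≤ p.2 := by
  rw [mem_epiCone]
  refine and_congr_right fun _ => ?_
  have key : (∀ x ∈ X, 0 ≤ logForm (fun α : A => (α : Fin n → ℝ) ⬝ᵥ x) p) ↔
      p.2 ∈ upperBounds (supportValues X (-expMap A p.1)) := by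
    rw [supportValues, mem_upperBounds, Set.forall_mem_image]
    refine forall₂_congr fun x _ => ?_
    rw [logForm_apply, neg_dotProduct, expMap_dotProduct, neg_le_iff_add_nonneg']
  rw [key]
  constructor
  · exact fun h => ⟨⟨_, h⟩, csSup_le (hX.image _) h⟩
  · rintro ⟨h1, h2⟩ y hy
    exact (le_csSup h1 hy).trans h2

theorem functionalForm_mem_epiCone (hX : X.Nonempty) {ν : A → ℝ} (hν : ν ∈ sumZeroCone A β)
    (hfin : SuppFinite A X ν) : functionalForm A X ν ∈ epiCone A X β :=
  (mem_epiCone_iff_suppVal_le hX).mpr ⟨hν, hfin, le_rfl⟩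

end Epigraph

/-! ### A finitely generated lift of the epigraph -/

section Lift

variable {n m : ℕ} {A : Finset (Fin n → ℝ)} {β : A} {M : Matrix (Fin m) (Fin n) ℝ} {b : Fin m → ℝ}

/-- The general linear form on `ℝ^A × ℝⁿ × ℝ`. -/
def liftForm (w : A → ℝ) (z : Fin n → ℝ) (s : ℝ) : (A → ℝ) × (Fin n → ℝ) × ℝ →ₗ[ℝ] ℝ where
  toFun p := ∑ α, p.1 α * w α + z ⬝ᵥ p.2.1 + s * p.2.2
  map_add' p q := by
    simp only [Prod.fst_add, Prod.snd_add, Pi.add_apply, add_mul, Finset.sum_add_distrib,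
      dotProduct_add]
    ring
  map_smul' r p := by
    simp only [Prod.smul_fst, Prod.smul_snd, Pi.smul_apply, smul_eq_mul, RingHom.id_apply, mul_add,
      Finset.mul_sum, mul_assoc, dotProduct_smul]
    ring

theorem liftForm_apply (w : A → ℝ) (z : Fin n → ℝ) (s : ℝ) (p : (A → ℝ) × (Fin n → ℝ) × ℝ) :
    liftForm w z s p = ∑ α, p.1 α * w α + z ⬝ᵥ p.2.1 + s * p.2.2 := rfl

theorem exists_eq_liftForm (f : (A → ℝ) × (Fin n → ℝ) × ℝ →ₗ[ℝ] ℝ) :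
    ∃ w z s, f = liftForm w z s := by
  classical
  refine ⟨fun α => f (Pi.single α 1, 0, 0), fun i => f (0, Pi.single i 1, 0), f (0, 0, 1), ?_⟩
  ext p
  · simp [liftForm_apply, Pi.single_apply]
    rfl
  · simp [liftForm_apply]
  · simp [liftForm_apply]

open Classical in
variable (A β M b) in
/-- Generators of the cone of all `(ν, Aν + Mᵀu, bᵀu + r)` with `ν ∈ N_β`, `u ≥ 0` and `r ≥ 0`.
By linear programming duality, its points of the form `(ν, 0, τ)` are those with `(ν, τ)` in
the epigraph of the support function of `{x | M x ≤ b}`. -/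
noncomputable def liftGenerators : Finset ((A → ℝ) × (Fin n → ℝ) × ℝ) :=
  Finset.univ.image (fun α : A =>
    (Pi.single α 1 - Pi.single β 1, (α : Fin n → ℝ) - (β : Fin n → ℝ), (0 : ℝ))) ∪
  Finset.univ.image (fun i : Fin m => (0, M i, b i)) ∪ {(0, 0, 1)}

theorem liftForm_nonneg_iff (w : A → ℝ) (z : Fin n → ℝ) (s : ℝ) :
    (∀ g ∈ liftGenerators A β M b, 0 ≤ liftForm w z s g) ↔
      (∀ α : A, 0 ≤ w α - w β + z ⬝ᵥ ((α : Fin n → ℝ) - (β : Fin n → ℝ))) ∧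
      (∀ i, 0 ≤ z ⬝ᵥ M i + s * b i) ∧ 0 ≤ s := by
  classical
  simp only [liftGenerators, Finset.mem_union, Finset.mem_image, Finset.mem_univ, true_and,
    Finset.mem_singleton, or_imp, forall_and, forall_exists_index, forall_apply_eq_imp_iff,
    forall_eq, and_assoc]
  simp [liftForm_apply, sub_mul, Pi.single_apply, Finset.sum_sub_distrib]

theorem neg_inv_smul_mem {z : Fin n → ℝ} {s : ℝ} (hs : 0 < s) (h : ∀ i, 0 ≤ z ⬝ᵥ M i + s * b i) :
    -(s⁻¹ • z) ∈ {x | M.mulVec x ≤ b} := by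
  intro i
  have h1 : s⁻¹ * (z ⬝ᵥ M i + s * b i) = s⁻¹ * (z ⬝ᵥ M i) + b i := by
    field_simp
  have h2 := mul_nonneg (inv_nonneg.mpr hs.le) (h i)
  rw [h1] at h2
  simp only [Matrix.mulVec, dotProduct_neg, dotProduct_smul, smul_eq_mul]
  rw [dotProduct_comm]
  linarith

theorem mem_epiCone_of_mem_hull_liftGenerators {p : (A → ℝ) × (Fin n → ℝ) × ℝ}
    (hp : p ∈ PointedCone.hull ℝ (liftGenerators A β M b : Set _)) (hp0 : p.2.1 = 0) :
    (p.1, p.2.2) ∈ epiCone A {x | M.mulVec x ≤ b} β := by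
  classical
  have key (w : A → ℝ) (z : Fin n → ℝ) (s : ℝ)
      (h : (∀ α : A, 0 ≤ w α - w β + z ⬝ᵥ ((α : Fin n → ℝ) - (β : Fin n → ℝ))) ∧
        (∀ i, 0 ≤ z ⬝ᵥ M i + s * b i) ∧ 0 ≤ s) : 0 ≤ ∑ α, p.1 α * w α + s * p.2.2 := by
    have := nonneg_of_mem_hull (liftForm w z s) ((liftForm_nonneg_iff w z s).mpr h) hp
    rwa [liftForm_apply, hp0, dotProduct_zero, add_zero] at this
  refine ⟨⟨fun α hα => ?_, le_antisymm ?_ ?_⟩, fun x hx => ?_⟩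
  · have := key (Pi.single α 1) 0 0 ⟨fun γ => ?_, by simp, le_rfl⟩
    · simpa [Pi.single_apply] using this
    · rw [zero_dotProduct, add_zero, Pi.single_eq_of_ne (Ne.symm hα), sub_zero]
      exact (Pi.single_nonneg.mpr zero_le_one : (0 : A → ℝ) ≤ Pi.single α 1) γ
  · have := key (fun _ => -1) 0 0 ⟨by simp, by simp, le_rfl⟩
    simpa using this
  · have := key (fun _ => 1) 0 0 ⟨by simp, by simp, le_rfl⟩
    simpa using this
  · have := key (fun α => (α : Fin n → ℝ) ⬝ᵥ x) (-x) 1 ⟨fun α => ?_, fun i => ?_, zero_le_one⟩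
    · simpa [logForm_apply] using this
    · rw [neg_dotProduct, dotProduct_comm x, sub_dotProduct]
      simp
    · have := hx i
      simp only [Matrix.mulVec] at this
      rw [neg_dotProduct, dotProduct_comm]
      linarith

theorem mem_hull_liftGenerators_of_mem_epiCone (hX : {x | M.mulVec x ≤ b}.Nonempty)
    {ν : A → ℝ} {τ : ℝ} (h : (ν, τ) ∈ epiCone A {x | M.mulVec x ≤ b} β) :
    (ν, (0 : Fin n → ℝ), τ) ∈ PointedCone.hull ℝ (liftGenerators A β M b : Set _) := by
  by_contra hcon
  obtain ⟨f, hf, hneg⟩ := exists_separating_functional _ _ hcon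
  obtain ⟨w, z, s, rfl⟩ := exists_eq_liftForm f
  obtain ⟨h1, h2, h3⟩ := (liftForm_nonneg_iff w z s).mp hf
  simp only [liftForm_apply, dotProduct_zero, add_zero] at hneg
  obtain ⟨hν, hτ⟩ := h
  have hmono : ∑ α, ν α * -((α : Fin n → ℝ) ⬝ᵥ z) ≤ ∑ α, ν α * w α := by
    refine logForm_mono hν fun α => ?_
    have := h1 α
    rw [dotProduct_sub, dotProduct_comm z, dotProduct_comm z] at this
    linarith
  simp only [mul_neg, Finset.sum_neg_distrib] at hmono
  rcases h3.eq_or_lt with rfl | hs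
  -- `-z` is a recession direction, along which `-Aν` is unbounded
  · obtain ⟨x₀, hx₀⟩ := hX
    set c := ∑ α, ν α * ((α : Fin n → ℝ) ⬝ᵥ z) with hc
    set k := ∑ α, ν α * ((α : Fin n → ℝ) ⬝ᵥ x₀) + τ
    have hc0 : 0 < c := by linarith
    have hk0 : 0 ≤ k := hτ x₀ hx₀
    have hx : x₀ - ((k + 1) / c) • z ∈ {x | M.mulVec x ≤ b} := by
      intro i
      have hi := hx₀ i
      have hz := h2 i
      simp only [Matrix.mulVec, dotProduct_sub, dotProduct_smul, smul_eq_mul] at hi ⊢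
      rw [zero_mul, add_zero, dotProduct_comm] at hz
      have := mul_nonneg (div_nonneg (by linarith : 0 ≤ k + 1) hc0.le) hz
      linarith
    have := hτ _ hx
    simp only [logForm_apply, dotProduct_sub, dotProduct_smul, smul_eq_mul, mul_sub,
      Finset.sum_sub_distrib] at this
    have h4 : ∑ α, ν α * ((k + 1) / c * ((α : Fin n → ℝ) ⬝ᵥ z)) = k + 1 := by
      refine Eq.trans ?_ (div_mul_cancel₀ (k + 1) hc0.ne')
      conv_rhs => rw [hc, Finset.mul_sum]
      exact Finset.sum_congr rfl fun α _ => by ring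
    linarith
  · have := hτ _ (neg_inv_smul_mem hs h2)
    simp only [logForm_apply, dotProduct_neg, dotProduct_smul, smul_eq_mul, mul_neg,
      Finset.sum_neg_distrib] at this
    have h4 : s * ∑ α, ν α * (s⁻¹ * ((α : Fin n → ℝ) ⬝ᵥ z)) =
        ∑ α, ν α * ((α : Fin n → ℝ) ⬝ᵥ z) := by
      rw [Finset.mul_sum]
      exact Finset.sum_congr rfl fun α _ => by field_simp
    have h5 := mul_nonneg hs.le this
    rw [mul_add, mul_neg, h4] at h5
    linarith

theorem epiCone_fg {X : Set (Fin n → ℝ)} (hX : IsPolyhedron X) (hne : X.Nonempty) (β : A) :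
    (epiCone A X β).FG := by
  obtain ⟨m, M, b, rfl⟩ := hX
  obtain ⟨D, hD, hmem⟩ := fg_inf_ker (C := PointedCone.hull ℝ (liftGenerators A β M b : Set _))
    ⟨_, rfl⟩ (LinearMap.fst ℝ (Fin n → ℝ) ℝ ∘ₗ LinearMap.snd ℝ (A → ℝ) ((Fin n → ℝ) × ℝ))
  let φ : (A → ℝ) × (Fin n → ℝ) × ℝ →ₗ[ℝ] (A → ℝ) × ℝ :=
    (LinearMap.fst ℝ _ _).prod (LinearMap.snd ℝ _ _ ∘ₗ LinearMap.snd ℝ _ _)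
  have : epiCone A {x | M.mulVec x ≤ b} β = D.map φ := by
    ext p
    rw [PointedCone.mem_map]
    constructor
    · intro hp
      exact ⟨(p.1, 0, p.2), (hmem _).mpr ⟨mem_hull_liftGenerators_of_mem_epiCone hne hp, rfl⟩, rfl⟩
    · rintro ⟨q, hq, rfl⟩
      obtain ⟨hq1, hq2⟩ := (hmem _).mp hq
      exact mem_epiCone_of_mem_hull_liftGenerators hq1 hq2
  rw [this]
  exact Submodule.FG.map _ hD

/-- If `w` is nonnegative on the epigraph of the support function over `N_β`, then the
log-linear functions `α ↦ αᵀx`, `x ∈ X`, include one that grows from `β` at most as `w` does. -/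
theorem exists_mem_of_logForm_nonneg {X : Set (Fin n → ℝ)} (hX : IsPolyhedron X) {w : A → ℝ}
    (hw : ∀ p ∈ epiCone A X β, 0 ≤ logForm w p) :
    ∃ x ∈ X, ∀ α : A, (α : Fin n → ℝ) ⬝ᵥ x - (β : Fin n → ℝ) ⬝ᵥ x ≤ w α - w β := by
  classical
  obtain ⟨m, M, b, rfl⟩ := hX
  let φ : (A → ℝ) × (Fin n → ℝ) × ℝ →ₗ[ℝ] (Fin n → ℝ) × ℝ :=
    (LinearMap.fst ℝ _ _ ∘ₗ LinearMap.snd ℝ _ _).prod (liftForm w 0 1)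
  have hφ : ((0, -1) : (Fin n → ℝ) × ℝ) ∉
      PointedCone.hull ℝ (((liftGenerators A β M b).image φ : Finset _) : Set _) := by
    rw [Finset.coe_image]
    intro h
    obtain ⟨p, hp, hpe⟩ := exists_of_mem_hull_image φ h
    obtain ⟨hp1, hp2⟩ := Prod.ext_iff.mp hpe
    have h1 := hw _ (mem_epiCone_of_mem_hull_liftGenerators hp hp1)
    have h2 : liftForm w 0 1 p = -1 := hp2
    rw [liftForm_apply, zero_dotProduct, add_zero, one_mul] at h2
    rw [logForm_apply] at h1
    linarith
  obtain ⟨f, hf, hneg⟩ := exists_separating_functional _ _ hφ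
  obtain ⟨w', z, s, hfe⟩ := exists_eq_liftForm (f ∘ₗ φ)
  set s₀ := f (0, 1) with hs₀
  have hfφ (p) : (f ∘ₗ φ) p = f (p.2.1, 0) + s₀ * (∑ α, p.1 α * w α + p.2.2) := by
    have h1 : φ p = (p.2.1, 0) + (∑ α, p.1 α * w α + p.2.2) • ((0, 1) : (Fin n → ℝ) × ℝ) := by
      simp [φ, liftForm_apply]
    rw [LinearMap.comp_apply, h1, map_add, map_smul, smul_eq_mul, mul_comm]
  have hs1 : s = s₀ := by
    have h1 := hfφ (0, 0, 1)
    rw [hfe] at h1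
    simpa [liftForm_apply, ← Prod.zero_eq_mk] using h1
  have hw' (α : A) : w' α = s₀ * w α := by
    have h1 := hfφ (Pi.single α 1, 0, 0)
    rw [hfe] at h1
    simpa [liftForm_apply, Pi.single_apply, ← Prod.zero_eq_mk] using h1
  obtain ⟨h1, h2, -⟩ := (liftForm_nonneg_iff (β := β) (M := M) (b := b) w' z s).mp
    (fun g hg => by rw [← hfe]; exact hf _ (Finset.mem_image_of_mem _ hg))
  have hs : 0 < s := by
    have : ((0, -1) : (Fin n → ℝ) × ℝ) = (-1 : ℝ) • (0, 1) := by simp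
    rw [this, map_smul, smul_eq_mul, ← hs₀, ← hs1] at hneg
    linarith
  refine ⟨_, neg_inv_smul_mem hs h2, fun α => ?_⟩
  have h3 := mul_nonneg (inv_nonneg.mpr hs.le) (h1 α)
  rw [hw', hw', ← hs1, dotProduct_sub, dotProduct_comm z, dotProduct_comm z] at h3
  simp only [dotProduct_neg, dotProduct_smul, smul_eq_mul]
  have h4 : s⁻¹ * (s * w α - s * w β + ((α : Fin n → ℝ) ⬝ᵥ z - (β : Fin n → ℝ) ⬝ᵥ z)) =
      w α - w β + (s⁻¹ * ((α : Fin n → ℝ) ⬝ᵥ z) - s⁻¹ * ((β : Fin n → ℝ) ⬝ᵥ z)) := by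
    field_simp
  linarith

end Lift

/-! ### Weighted geometric means -/

section GeometricMean

variable {ι : Type*}

/-- Weighted geometric means are superadditive: apply the inequality of arithmetic and geometric
means to `a / (a + b)` and to `b / (a + b)`. -/
theorem geom_mean_add_le (s : Finset ι) (w a b : ι → ℝ) (hw : ∀ i ∈ s, 0 < w i)
    (hw1 : ∑ i ∈ s, w i = 1) (ha : ∀ i ∈ s, 0 ≤ a i) (hb : ∀ i ∈ s, 0 ≤ b i) :
    ∏ i ∈ s, a i ^ w i + ∏ i ∈ s, b i ^ w i ≤ ∏ i ∈ s, (a i + b i) ^ w i := by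
  by_cases h : ∃ i ∈ s, a i + b i = 0
  · obtain ⟨i, hi, h0⟩ := h
    have hai : a i = 0 := by linarith [ha i hi, hb i hi]
    have hbi : b i = 0 := by linarith [ha i hi, hb i hi]
    rw [Finset.prod_eq_zero hi (by rw [hai, Real.zero_rpow (hw i hi).ne']),
      Finset.prod_eq_zero hi (by rw [hbi, Real.zero_rpow (hw i hi).ne']), add_zero]
    exact Finset.prod_nonneg fun i hi => Real.rpow_nonneg (add_nonneg (ha i hi) (hb i hi)) _
  · push Not at h
    have hpos : ∀ i ∈ s, 0 < a i + b i := fun i hi =>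
      lt_of_le_of_ne (add_nonneg (ha i hi) (hb i hi)) (h i hi).symm
    have hD : 0 ≤ ∏ i ∈ s, (a i + b i) ^ w i :=
      Finset.prod_nonneg fun i hi => Real.rpow_nonneg (hpos i hi).le _
    have key (c : ι → ℝ) (hc : ∀ i ∈ s, 0 ≤ c i) : ∏ i ∈ s, c i ^ w i ≤
        (∑ i ∈ s, w i * (c i / (a i + b i))) * ∏ i ∈ s, (a i + b i) ^ w i := by
      have h1 := Real.geom_mean_le_arith_mean_weighted s w (fun i => c i / (a i + b i))
        (fun i hi => (hw i hi).le) hw1 (fun i hi => div_nonneg (hc i hi) (hpos i hi).le)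
      refine le_trans (le_of_eq ?_) (mul_le_mul_of_nonneg_right h1 hD)
      rw [← Finset.prod_mul_distrib]
      refine Finset.prod_congr rfl fun i hi => ?_
      rw [← Real.mul_rpow (div_nonneg (hc i hi) (hpos i hi).le) (hpos i hi).le,
        div_mul_cancel₀ _ (hpos i hi).ne']
    have hsum : ∑ i ∈ s, w i * (a i / (a i + b i)) + ∑ i ∈ s, w i * (b i / (a i + b i)) = 1 := by
      rw [← Finset.sum_add_distrib, ← hw1]
      refine Finset.sum_congr rfl fun i hi => ?_
      rw [← mul_add, ← add_div, div_self (hpos i hi).ne', mul_one]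
    refine (add_le_add (key a ha) (key b hb)).trans (le_of_eq ?_)
    rw [← add_mul, hsum, one_mul]

end GeometricMean

/-! ### Closed sums of cones -/

section Closed

variable {E : Type*} [AddCommGroup E] [Module ℝ E] [TopologicalSpace E] [IsTopologicalAddGroup E]
  [ContinuousSMul ℝ E] [T2Space E] [FiniteDimensional ℝ E] [FirstCountableTopology E]

/-- Closed sets on which an injective linear map into some `ℝ^κ` is nonnegative have a closed sum:
in a convergent sequence of sums, the summands stay in a compact order interval. -/
theorem isClosed_add_of_nonneg {κ : Type*} [Finite κ] (f : E →ₗ[ℝ] (κ → ℝ))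
    (hf : LinearMap.ker f = ⊥) {C D : Set E} (hC : IsClosed C) (hD : IsClosed D)
    (hC0 : ∀ c ∈ C, 0 ≤ f c) (hD0 : ∀ d ∈ D, 0 ≤ f d) : IsClosed (C + D) := by
  cases nonempty_fintype κ
  have hemb := LinearMap.isClosedEmbedding_of_injective hf
  refine IsSeqClosed.isClosed fun x a hx hxa => ?_
  choose c hc d hd hcd using fun k => Set.mem_add.mp (hx k)
  have hfx : Filter.Tendsto (fun k => f (x k)) Filter.atTop (nhds (f a)) :=
    (hemb.continuous.tendsto a).comp hxa
  obtain ⟨B, hB⟩ := hfx.bddAbove_range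
  have hcK : ∀ k, c k ∈ f ⁻¹' Set.Icc 0 B := fun k => ⟨hC0 _ (hc k), by
    refine le_trans ?_ (hB ⟨k, rfl⟩)
    change f (c k) ≤ f (x k)
    rw [← hcd k, map_add]
    exact le_add_of_nonneg_right (hD0 _ (hd k))⟩
  obtain ⟨c₀, -, φ, hφ, hlim⟩ := (hemb.isCompact_preimage isCompact_Icc).tendsto_subseq hcK
  have hlim' : Filter.Tendsto (d ∘ φ) Filter.atTop (nhds (a - c₀)) := by
    have : d ∘ φ = fun k => x (φ k) - c (φ k) := by
      ext k
      rw [← hcd]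
      simp
    rw [this]
    exact (hxa.comp hφ.tendsto_atTop).sub hlim
  exact Set.mem_add.mpr ⟨c₀, hC.mem_of_tendsto hlim (Filter.Eventually.of_forall fun k => hc _),
    a - c₀, hD.mem_of_tendsto hlim' (Filter.Eventually.of_forall fun k => hd _), by abel⟩

theorem isClosed_sum_of_nonneg {ι κ : Type*} [Finite κ] (f : E →ₗ[ℝ] (κ → ℝ))
    (hf : LinearMap.ker f = ⊥) (s : Finset ι) (C : ι → Set E) (hC : ∀ i ∈ s, IsClosed (C i))
    (hC0 : ∀ i ∈ s, ∀ c ∈ C i, 0 ≤ f c) : IsClosed (∑ i ∈ s, C i) := by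
  classical
  suffices h : IsClosed (∑ i ∈ s, C i) ∧ ∀ c ∈ ∑ i ∈ s, C i, 0 ≤ f c from h.1
  induction s using Finset.induction_on with
  | empty => simp
  | insert i s hi ih =>
    obtain ⟨h1, h2⟩ := ih (fun j hj => hC j (Finset.mem_insert_of_mem hj))
      (fun j hj => hC0 j (Finset.mem_insert_of_mem hj))
    have hi' := Finset.mem_insert_self i s
    rw [Finset.sum_insert hi]
    refine ⟨isClosed_add_of_nonneg f hf (hC i hi') h1 (hC0 i hi') h2, ?_⟩
    rintro _ ⟨c, hc, d, hd, rfl⟩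
    change 0 ≤ f (c + d)
    rw [map_add]
    exact add_nonneg (hC0 i hi' c hc) (h2 d hd)

end Closed

/-! ### Witnessed AGE cones and their pairing with positive vectors -/

section Witnessed

variable {n : ℕ} {A : Finset (Fin n → ℝ)} {X : Set (Fin n → ℝ)} {β : A} {lam : A → ℝ}

theorem sum_eq_sum_pos_sub (hlam : lam ∈ sumZeroCone A β) (hβ : lam β = -1) (z : A → ℝ) :
    ∑ α, lam α * z α = ∑ α with 0 < lam α, lam α * z α - z β := by
  classical
  rw [← Finset.sum_filter_add_sum_filter_not Finset.univ (fun α => 0 < lam α), sub_eq_add_neg]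
  congr 1
  rw [Finset.sum_eq_single_of_mem β (by simp [hβ])]
  · rw [hβ, neg_one_mul]
  · intro α hα hαβ
    rw [le_antisymm (not_lt.mp (Finset.mem_filter.mp hα).2) (hlam.1 α hαβ), zero_mul]

theorem sum_pos_eq_one (hlam : lam ∈ sumZeroCone A β) (hβ : lam β = -1) :
    ∑ α with 0 < lam α, lam α = 1 := by
  have h := sum_eq_sum_pos_sub hlam hβ 1
  simp only [Pi.one_apply, mul_one, hlam.2] at h
  linarith

theorem ne_of_pos (hβ : lam β = -1) {α : A} (h : 0 < lam α) : α ≠ β := by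
  rintro rfl
  linarith

theorem mem_witnessedCone (hlam : lam ∈ sumZeroCone A β) (hβ : lam β = -1) {c : A → ℝ} :
    c ∈ witnessedCone A X lam ↔ (∀ α, α ≠ β → 0 ≤ c α) ∧
      -c β * Real.exp (suppVal A X lam) ≤ ∏ α : A with 0 < lam α, (c α / lam α) ^ (lam α) := by
  constructor
  · rintro ⟨γ, -, hγ', h1, h2⟩
    have : γ = β := by
      by_contra hne
      linarith [hlam.1 γ hne]
    subst this
    exact ⟨h1, h2⟩
  · rintro ⟨h1, h2⟩
    exact ⟨β, hlam, hβ, h1, h2⟩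

theorem nonneg_mem_witnessedCone (hlam : lam ∈ sumZeroCone A β) (hβ : lam β = -1) {c : A → ℝ}
    (hc : 0 ≤ c) : c ∈ witnessedCone A X lam := by
  refine (mem_witnessedCone hlam hβ).mpr ⟨fun α _ => hc α, le_trans ?_ (Finset.prod_nonneg
    fun α hα => Real.rpow_nonneg (div_nonneg (hc α) (Finset.mem_filter.mp hα).2.le) _)⟩
  exact mul_nonpos_of_nonpos_of_nonneg (neg_nonpos.mpr (hc β)) (Real.exp_pos _).le

theorem witnessedCone_add (hlam : lam ∈ sumZeroCone A β) (hβ : lam β = -1) {c d : A → ℝ}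
    (hc : c ∈ witnessedCone A X lam) (hd : d ∈ witnessedCone A X lam) :
    c + d ∈ witnessedCone A X lam := by
  rw [mem_witnessedCone hlam hβ] at hc hd ⊢
  refine ⟨fun α hα => add_nonneg (hc.1 α hα) (hd.1 α hα), ?_⟩
  have hpos (e : A → ℝ) (he : ∀ α, α ≠ β → 0 ≤ e α) :
      ∀ α ∈ Finset.univ.filter (fun α => 0 < lam α), 0 ≤ e α / lam α := fun α hα =>
    div_nonneg (he α (ne_of_pos hβ (Finset.mem_filter.mp hα).2)) (Finset.mem_filter.mp hα).2.le
  have h := geom_mean_add_le (Finset.univ.filter fun α => 0 < lam α) lam (fun α => c α / lam α)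
    (fun α => d α / lam α) (fun α hα => (Finset.mem_filter.mp hα).2) (sum_pos_eq_one hlam hβ)
    (hpos c hc.1) (hpos d hd.1)
  simp only [← add_div] at h
  refine le_trans ?_ h
  rw [Pi.add_apply, neg_add, add_mul]
  exact add_le_add hc.2 hd.2

theorem witnessedCone_smul (hlam : lam ∈ sumZeroCone A β) (hβ : lam β = -1) {c : A → ℝ}
    (hc : c ∈ witnessedCone A X lam) {r : ℝ} (hr : 0 ≤ r) : r • c ∈ witnessedCone A X lam := by
  rw [mem_witnessedCone hlam hβ] at hc ⊢
  refine ⟨fun α hα => mul_nonneg hr (hc.1 α hα), ?_⟩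
  have h : ∏ α : A with 0 < lam α, ((r • c) α / lam α) ^ (lam α) =
      r * ∏ α : A with 0 < lam α, (c α / lam α) ^ (lam α) := by
    have h1 : r = ∏ α : A with 0 < lam α, r ^ lam α := by
      rw [← Real.rpow_sum_of_nonneg hr fun α hα => (Finset.mem_filter.mp hα).2.le,
        sum_pos_eq_one hlam hβ, Real.rpow_one]
    conv_rhs => rw [h1, ← Finset.prod_mul_distrib]
    refine Finset.prod_congr rfl fun α hα => ?_
    have hα := (Finset.mem_filter.mp hα).2
    rw [Pi.smul_apply, smul_eq_mul, mul_div_assoc,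
      Real.mul_rpow hr (div_nonneg (hc.1 α (ne_of_pos hβ hα)) hα.le)]
  rw [h, Pi.smul_apply, smul_eq_mul, ← mul_neg, mul_assoc]
  exact mul_le_mul_of_nonneg_left hc.2 hr

theorem isClosed_witnessedCone (hlam : lam ∈ sumZeroCone A β) (hβ : lam β = -1) :
    IsClosed (witnessedCone A X lam) := by
  have : witnessedCone A X lam = {c | ∀ α, α ≠ β → 0 ≤ c α} ∩
      {c | -c β * Real.exp (suppVal A X lam) ≤
        ∏ α : A with 0 < lam α, (c α / lam α) ^ (lam α)} :=
    Set.ext fun c => mem_witnessedCone hlam hβ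
  rw [this]
  refine IsClosed.inter ?_ (isClosed_le (by fun_prop) ?_)
  · simp only [Set.ofPred_forall]
    exact isClosed_iInter fun α => isClosed_iInter fun _ =>
      isClosed_le continuous_const (continuous_apply α)
  · refine continuous_finsetProd _ fun α hα => ?_
    exact ((continuous_apply α).div_const _).rpow_const fun _ =>
      Or.inr (Finset.mem_filter.mp hα).2.le

theorem prod_rpow_eq_exp {v : A → ℝ} (hv : ∀ α, 0 < v α) :
    ∏ α : A with 0 < lam α, v α ^ lam α =
      Real.exp (∑ α with 0 < lam α, lam α * Real.log (v α)) := by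
  rw [Real.exp_sum]
  exact Finset.prod_congr rfl fun α _ => by rw [Real.rpow_def_of_pos (hv α), mul_comm]

theorem logForm_functionalForm (hlam : lam ∈ sumZeroCone A β) (hβ : lam β = -1) (w : A → ℝ) :
    logForm w (functionalForm A X lam) =
      ∑ α with 0 < lam α, lam α * w α - w β + suppVal A X lam := by
  rw [logForm_apply, functionalForm, sum_eq_sum_pos_sub hlam hβ]

/-- A positive vector `v` lies in the dual of the `λ`-witnessed cone as soon as the linear form of
`log v` is nonnegative at `φ_λ`. This is the weighted inequality of arithmetic and geometric
means. -/
theorem pairing_nonneg (hlam : lam ∈ sumZeroCone A β) (hβ : lam β = -1) {v : A → ℝ}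
    (hv : ∀ α, 0 < v α)
    (hL : 0 ≤ logForm (fun α => Real.log (v α)) (functionalForm A X lam)) {c : A → ℝ}
    (hc : c ∈ witnessedCone A X lam) : 0 ≤ ∑ α, c α * v α := by
  classical
  obtain ⟨hc0, hc1⟩ := (mem_witnessedCone hlam hβ).mp hc
  set P : Finset A := Finset.univ.filter fun α => 0 < lam α
  set G := ∏ α ∈ P, (c α / lam α) ^ lam α with hG
  set V := ∏ α ∈ P, v α ^ lam α with hV
  have hPpos : ∀ α ∈ P, 0 < lam α := fun α hα => (Finset.mem_filter.mp hα).2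
  have hPc : ∀ α ∈ P, 0 ≤ c α / lam α := fun α hα =>
    div_nonneg (hc0 α (ne_of_pos hβ (hPpos α hα))) (hPpos α hα).le
  have hG0 : 0 ≤ G := Finset.prod_nonneg fun α hα => Real.rpow_nonneg (hPc α hα) _
  have hVe : Real.exp (-suppVal A X lam) * v β ≤ V := by
    rw [hV, prod_rpow_eq_exp hv]
    conv_lhs => rw [← Real.exp_log (hv β), ← Real.exp_add]
    refine Real.exp_le_exp.mpr ?_
    rw [logForm_functionalForm hlam hβ] at hL
    linarith
  have hV0 : 0 ≤ V := Finset.prod_nonneg fun α _ => Real.rpow_nonneg (hv α).le _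
  have hamgm : G * V ≤ ∑ α ∈ P, c α * v α := by
    have h := Real.geom_mean_le_arith_mean_weighted P lam (fun α => c α / lam α * v α)
      (fun α hα => (hPpos α hα).le) (sum_pos_eq_one hlam hβ)
      (fun α hα => mul_nonneg (hPc α hα) (hv α).le)
    refine le_trans (le_of_eq ?_) (h.trans (le_of_eq ?_))
    · rw [hG, hV, ← Finset.prod_mul_distrib]
      exact Finset.prod_congr rfl fun α hα => (Real.mul_rpow (hPc α hα) (hv α).le).symm
    · refine Finset.sum_congr rfl fun α hα => ?_
      rw [← mul_assoc, mul_div_cancel₀ _ (hPpos α hα).ne']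
  have hβP : β ∉ P := fun h => ne_of_pos hβ (hPpos β h) rfl
  have hsub : c β * v β + ∑ α ∈ P, c α * v α ≤ ∑ α, c α * v α := by
    rw [← Finset.sum_insert (f := fun α => c α * v α) hβP]
    refine Finset.sum_le_sum_of_subset_of_nonneg (Finset.subset_univ _) fun α _ hα => ?_
    refine mul_nonneg (hc0 α ?_) (hv α).le
    rintro rfl
    exact hα (Finset.mem_insert_self _ _)
  refine le_trans ?_ hsub
  rcases le_or_gt 0 (c β) with hcβ | hcβ
  · exact add_nonneg (mul_nonneg hcβ (hv β).le) ((mul_nonneg hG0 hV0).trans hamgm)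
  · have h1 : -c β * v β ≤ G * V := by
      calc -c β * v β = -c β * Real.exp (suppVal A X lam) *
            (Real.exp (-suppVal A X lam) * v β) := by
            rw [mul_assoc, ← mul_assoc (Real.exp _), ← Real.exp_add, add_neg_cancel, Real.exp_zero,
              one_mul]
        _ ≤ -c β * Real.exp (suppVal A X lam) * V :=
            mul_le_mul_of_nonneg_left hVe
              (mul_nonneg (neg_nonneg.mpr hcβ.le) (Real.exp_pos _).le)
        _ ≤ G * V := mul_le_mul_of_nonneg_right hc1 hV0
    linarith

/-- Equality in the inequality of arithmetic and geometric means produces a boundary point of the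
`λ`-witnessed cone whose pairing with `v` has the sign of the linear form of `log v` at `φ_λ`. -/
theorem exists_mem_witnessedCone (hlam : lam ∈ sumZeroCone A β) (hβ : lam β = -1) {v : A → ℝ}
    (hv : ∀ α, 0 < v α) : ∃ c ∈ witnessedCone A X lam, c ≠ 0 ∧
      ∑ α, c α * v α =
        1 - Real.exp (-logForm (fun α => Real.log (v α)) (functionalForm A X lam)) := by
  classical
  set e := Real.exp (-suppVal A X lam - ∑ α with 0 < lam α, lam α * Real.log (v α)) with he
  set c : A → ℝ := fun α => if α = β then -e else lam α / v α with hc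
  have hcβ : c β = -e := if_pos rfl
  have hcα {α : A} (h : α ≠ β) : c α = lam α / v α := if_neg h
  refine ⟨c, (mem_witnessedCone hlam hβ).mpr ⟨fun α hα => ?_, ?_⟩, fun h0 => ?_, ?_⟩
  · rw [hcα hα]
    exact div_nonneg (hlam.1 α hα) (hv α).le
  · have h1 : ∏ α : A with 0 < lam α, (c α / lam α) ^ lam α =
        ∏ α : A with 0 < lam α, ((v α)⁻¹) ^ lam α := by
      refine Finset.prod_congr rfl fun α hα => ?_
      have hα := (Finset.mem_filter.mp hα).2
      rw [hcα (ne_of_pos hβ hα), div_right_comm, div_self hα.ne', one_div]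
    rw [h1, prod_rpow_eq_exp fun α => inv_pos.mpr (hv α), hcβ, neg_neg, he, ← Real.exp_add]
    refine Real.exp_le_exp.mpr (le_of_eq ?_)
    simp only [Real.log_inv, mul_neg, Finset.sum_neg_distrib]
    ring
  · have h1 := congrFun h0 β
    rw [hcβ, Pi.zero_apply, neg_eq_zero] at h1
    exact (Real.exp_pos _).ne' h1
  · have h1 : ∑ α, c α * v α = c β * v β + ∑ α ∈ Finset.univ.erase β, lam α := by
      rw [← Finset.add_sum_erase _ _ (Finset.mem_univ β)]
      congr 1
      refine Finset.sum_congr rfl fun α hα => ?_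
      rw [hcα (Finset.ne_of_mem_erase hα), div_mul_cancel₀ _ (hv α).ne']
    have h2 : ∑ α ∈ Finset.univ.erase β, lam α = 1 := by
      have := hlam.2
      rw [← Finset.add_sum_erase _ _ (Finset.mem_univ β), hβ] at this
      linarith
    have h3 : e * v β =
        Real.exp (-logForm (fun α => Real.log (v α)) (functionalForm A X lam)) := by
      conv_lhs => rw [← Real.exp_log (hv β), he, ← Real.exp_add]
      rw [logForm_functionalForm hlam hβ]
      congr 1
      ring
    rw [h1, h2, hcβ, neg_mul, h3]
    ring

theorem witnessedCone_subset_ageCone (hX : X.Nonempty) (hlam : lam ∈ sumZeroCone A β)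
    (hβ : lam β = -1) (hfin : SuppFinite A X lam) :
    witnessedCone A X lam ⊆ ageCone A X β := by
  intro c hc
  refine ⟨((mem_witnessedCone hlam hβ).mp hc).1, fun x hx => ?_⟩
  refine pairing_nonneg hlam hβ (v := fun α => expMonomial α x) (fun α => Real.exp_pos _) ?_ hc
  simp only [expMonomial, Real.log_exp]
  exact (functionalForm_mem_epiCone hX hlam hfin).2 x hx

theorem ageCone_subset_sageCone (β : A) : ageCone A X β ⊆ sageCone A X := by
  classical
  intro c hc
  rw [sageCone, Set.mem_finsetSum]
  refine ⟨Pi.single β c, fun {γ} _ => ?_, Finset.sum_pi_single' β c Finset.univ |>.trans (by simp)⟩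
  by_cases h : γ = β
  · subst h
    rwa [Pi.single_eq_same]
  · rw [Pi.single_eq_of_ne h]
    exact ⟨fun _ _ => le_rfl, fun x _ => by simp [signomial]⟩

theorem signomial_nonneg_of_mem_sageCone {c : A → ℝ} (hc : c ∈ sageCone A X) {x : Fin n → ℝ}
    (hx : x ∈ X) : 0 ≤ signomial A c x := by
  rw [sageCone, Set.mem_finsetSum] at hc
  obtain ⟨g, hg, rfl⟩ := hc
  simp only [signomial, Finset.sum_apply, Finset.sum_mul]
  rw [Finset.sum_comm]
  exact Finset.sum_nonneg fun β hβ => (hg hβ).2 x hx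

/-- Linear independence of the exponentials on `X` is already witnessed by finitely many points. -/
theorem exists_finset_separating (hind : ExpLinIndepOn A X) :
    ∃ Y : Finset (A → ℝ), (∀ y ∈ Y, ∃ x ∈ X, y = fun α : A => expMonomial α x) ∧
      ∀ c : A → ℝ, (∀ y ∈ Y, ∑ α, c α * y α = 0) → c = 0 := by
  classical
  set S : Set (A → ℝ) := (fun x => fun α : A => expMonomial α x) '' X with hS
  have hfg : (Submodule.span ℝ S).FG := IsNoetherian.noetherian _
  obtain ⟨Y, hYS, hY⟩ := (Submodule.fg_span_iff_fg_span_finset_subset S).mp hfg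
  refine ⟨Y, fun y hy => ?_, fun c hc => ?_⟩
  · obtain ⟨x, hx, rfl⟩ := hYS hy
    exact ⟨x, hx, rfl⟩
  · let f : (A → ℝ) →ₗ[ℝ] ℝ := Fintype.linearCombination ℝ c
    have hf (y : A → ℝ) : f y = ∑ α, c α * y α := by
      simp [f, Fintype.linearCombination_apply, mul_comm]
    have hle : Submodule.span ℝ S ≤ LinearMap.ker f := by
      rw [hY, Submodule.span_le]
      intro y hy
      rw [SetLike.mem_coe, LinearMap.mem_ker, hf]
      exact hc y hy
    refine funext fun α => Fintype.linearIndependent_iff.mp hind c (funext fun x => ?_) α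
    have := hle (Submodule.subset_span ⟨(x : Fin n → ℝ), x.2, rfl⟩)
    rw [LinearMap.mem_ker, hf] at this
    simpa using this

end Witnessed

/-! ### Circuits, extreme rays and the circuit graph -/

section Circuits

variable {n : ℕ} {A : Finset (Fin n → ℝ)} {X : Set (Fin n → ℝ)} {β : A} {lam : A → ℝ}

theorem sum_mul_nonneg_of_mem_sageCone {Y : Finset (A → ℝ)}
    (hYX : ∀ y ∈ Y, ∃ x ∈ X, y = fun α : A => expMonomial α x) {c : A → ℝ} (hc : c ∈ sageCone A X)
    {y : A → ℝ} (hy : y ∈ Y) : 0 ≤ ∑ α, c α * y α := by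
  obtain ⟨x, hx, rfl⟩ := hYX y hy
  exact signomial_nonneg_of_mem_sageCone hc hx

/-- A positive functional on the SAGE cone: the sum of evaluations at finitely many points that
separate signomials. -/
theorem exists_pos_functional (hind : ExpLinIndepOn A X) :
    ∃ v : A → ℝ, (∀ α, 0 < v α) ∧ ∀ c ∈ sageCone A X, c ≠ 0 → 0 < ∑ α, c α * v α := by
  classical
  obtain ⟨Y, hYX, hY⟩ := exists_finset_separating hind
  refine ⟨∑ y ∈ Y, y, fun α => ?_, fun c hc hc0 => ?_⟩
  · have hne : Y.Nonempty := by
      by_contra h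
      rw [Finset.not_nonempty_iff_eq_empty] at h
      subst h
      simpa using congrFun (hY (Pi.single α 1) (by simp)) α
    rw [Finset.sum_apply]
    refine Finset.sum_pos (fun y hy => ?_) hne
    obtain ⟨x, -, rfl⟩ := hYX y hy
    exact Real.exp_pos _
  · have h1 : ∑ α, c α * (∑ y ∈ Y, y) α = ∑ y ∈ Y, ∑ α, c α * y α := by
      simp only [Finset.sum_apply, Finset.mul_sum]
      exact Finset.sum_comm
    have h2 : ∀ y ∈ Y, 0 ≤ ∑ α, c α * y α := fun y hy =>
      sum_mul_nonneg_of_mem_sageCone hYX hc hy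
    rw [h1]
    refine lt_of_le_of_ne (Finset.sum_nonneg h2) fun h => hc0 (hY c ?_)
    exact (Finset.sum_eq_zero_iff_of_nonneg h2).mp h.symm

theorem neg_of_ne_zero {ν : A → ℝ} (hν : ν ∈ sumZeroCone A β) (h0 : ν ≠ 0) : ν β < 0 := by
  by_contra! h
  have hnn : ∀ α, 0 ≤ ν α := fun α => by
    by_cases hα : α = β
    · rwa [hα]
    · exact hν.1 α hα
  exact h0 (funext fun α => (Finset.sum_eq_zero_iff_of_nonneg fun α _ => hnn α).mp hν.2 α
    (Finset.mem_univ α))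

theorem normalize {ν : A → ℝ} (hν : ν ∈ sumZeroCone A β) (h0 : ν ≠ 0) :
    (-ν β)⁻¹ • ν ∈ sumZeroCone A β ∧ ((-ν β)⁻¹ • ν) β = -1 := by
  have h := neg_of_ne_zero hν h0
  refine ⟨sumZeroCone_smul hν (inv_nonneg.mpr (neg_nonneg.mpr h.le)), ?_⟩
  rw [Pi.smul_apply, smul_eq_mul, inv_neg, neg_mul, inv_mul_cancel₀ h.ne]

theorem snd_nonneg_of_mem_epiCone (hX : X.Nonempty) {τ : ℝ}
    (h : ((0 : A → ℝ), τ) ∈ epiCone A X β) : 0 ≤ τ := by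
  obtain ⟨x, hx⟩ := hX
  simpa [logForm_apply] using h.2 x hx

theorem zero_mk_mem_epiCone {τ : ℝ} (h : 0 ≤ τ) : ((0 : A → ℝ), τ) ∈ epiCone A X β :=
  ⟨⟨fun _ _ => le_rfl, by simp⟩, fun x _ => by simpa [logForm_apply] using h⟩

/-- The logarithm of a positive functional on the SAGE cone is positive on the epigraphs of the
support function, since it pairs positively with a nonzero member of each witnessed cone. In
particular these epigraphs, and the circuit graph, are pointed. -/
theorem logForm_pos (hX : X.Nonempty) {v : A → ℝ} (hv : ∀ α, 0 < v α)
    (hpos : ∀ c ∈ sageCone A X, c ≠ 0 → 0 < ∑ α, c α * v α) {p : (A → ℝ) × ℝ}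
    (hp : p ∈ epiCone A X β) (hp0 : p ≠ 0) : 0 < logForm (fun α => Real.log (v α)) p := by
  obtain ⟨ν, τ⟩ := p
  by_cases hν0 : ν = 0
  · subst hν0
    have h1 := snd_nonneg_of_mem_epiCone hX hp
    have h2 : τ ≠ 0 := by
      rintro rfl
      exact hp0 rfl
    simpa [logForm_apply] using lt_of_le_of_ne h1 h2.symm
  · obtain ⟨h1, h2⟩ := normalize hp.1 hν0
    have hr : 0 < (-ν β)⁻¹ := inv_pos.mpr (neg_pos.mpr (neg_of_ne_zero hp.1 hν0))
    obtain ⟨-, hfin, hle⟩ := (mem_epiCone_iff_suppVal_le hX).mp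
      (PointedCone.smul_mem (epiCone A X β) hr.le hp)
    obtain ⟨c, hc, hc0, hce⟩ := exists_mem_witnessedCone (X := X) h1 h2 hv
    have hcpos := hpos c (ageCone_subset_sageCone β
      (witnessedCone_subset_ageCone hX h1 h2 hfin hc)) hc0
    rw [hce, sub_pos, Real.exp_lt_one_iff, neg_lt_zero] at hcpos
    have h3 : logForm (fun α => Real.log (v α)) (functionalForm A X ((-ν β)⁻¹ • ν)) ≤
        logForm (fun α => Real.log (v α)) ((-ν β)⁻¹ • (ν, τ)) :=
      add_le_add le_rfl hle
    rw [map_smul, smul_eq_mul] at h3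
    exact pos_of_mul_pos_right (hcpos.trans_le h3) hr.le

/-- An extreme ray of the epigraph of the support function over `N_β` is vertical or generated by a
normalized circuit. -/
theorem extreme_ray_epiCone (hX : X.Nonempty) {p : (A → ℝ) × ℝ}
    (hp : GeneratesExtremeRay (epiCone A X β) p) :
    ∃ q ∈ functionalForm A X '' normalizedCircuits A X ∪ {(0, 1)},
      p ∈ PointedCone.hull ℝ {q} := by
  obtain ⟨hp0, hF⟩ := hp
  have hpE : p ∈ epiCone A X β := hF.le (Submodule.subset_span rfl)
  obtain ⟨ν, τ⟩ := p
  by_cases hν0 : ν = 0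
  · subst hν0
    exact ⟨(0, 1), Or.inr rfl,
      mem_hull_singleton.mpr ⟨τ, snd_nonneg_of_mem_epiCone hX hpE, by simp⟩⟩
  obtain ⟨hlam, hβ⟩ := normalize hpE.1 hν0
  have hr0 : 0 < -ν β := neg_pos.mpr (neg_of_ne_zero hpE.1 hν0)
  set r := (-ν β)⁻¹ with hr
  have hrpos : 0 < r := inv_pos.mpr hr0
  have hqE := PointedCone.smul_mem (epiCone A X β) hrpos.le hpE
  obtain ⟨-, hfin, hle⟩ := (mem_epiCone_iff_suppVal_le hX).mp hqE
  change SuppFinite A X (r • ν) at hfin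
  change suppVal A X (r • ν) ≤ r * τ at hle
  have hqmem : r • (ν, τ) ∈ PointedCone.hull ℝ {(ν, τ)} := mem_hull_singleton.mpr ⟨r, hrpos.le, rfl⟩
  have hφE := functionalForm_mem_epiCone hX hlam hfin
  -- the vertical part of an extreme point above the graph is zero
  have hτ : suppVal A X (r • ν) = r * τ := by
    have hsplit : functionalForm A X (r • ν) + (0, r * τ - suppVal A X (r • ν)) = r • (ν, τ) := by
      simp [functionalForm]
    obtain ⟨s, -, hs⟩ := mem_hull_singleton.mp (hF.mem_of_add_mem_right hφE
      (zero_mk_mem_epiCone (sub_nonneg.mpr hle)) (hsplit ▸ hqmem))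
    obtain ⟨hs1, hs2⟩ := Prod.ext_iff.mp hs
    have hs0 : s = 0 := (smul_eq_zero.mp hs1.symm).resolve_right hν0
    rw [hs0, zero_smul] at hs2
    exact (sub_eq_zero.mp hs2).symm
  have hφ : functionalForm A X (r • ν) = r • (ν, τ) := by
    rw [functionalForm, hτ]
    rfl
  have hlam0 : r • ν ≠ 0 := smul_ne_zero hrpos.ne' hν0
  refine ⟨functionalForm A X (r • ν), Or.inl ⟨r • ν, ⟨β, ⟨hlam, hlam0, hfin, ?_⟩, hβ⟩, rfl⟩,
    mem_hull_singleton.mpr ⟨-ν β, hr0.le, ?_⟩⟩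
  · rintro ⟨ν₁, hν₁, ν₂, hν₂, hli, ⟨a, b, ha, hb, hab, hlc⟩, hfin₁, hfin₂, hlin⟩
    have hval := hlin b ⟨hb.le, by linarith⟩
    rw [show 1 - b = a by linarith, hlc] at hval
    have hφs : a • functionalForm A X ν₁ + b • functionalForm A X ν₂ = r • (ν, τ) := by
      rw [← hφ]
      exact Prod.ext hlc hval.symm
    have h₁ := functionalForm_mem_epiCone hX hν₁ hfin₁
    have h₂ := functionalForm_mem_epiCone hX hν₂ hfin₂
    obtain ⟨s₁, -, hs₁⟩ := mem_hull_singleton.mp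
      (hF.mem_of_smul_add_smul_mem_left h₁ h₂ ha hb (hφs ▸ hqmem))
    obtain ⟨s₂, -, hs₂⟩ := mem_hull_singleton.mp
      (hF.mem_of_smul_add_smul_mem_right h₁ h₂ ha hb (hφs ▸ hqmem))
    have e₁ : ν₁ = s₁ • ν := congrArg Prod.fst hs₁
    have e₂ : ν₂ = s₂ • ν := congrArg Prod.fst hs₂
    have := (LinearIndependent.pair_iff.mp hli) s₂ (-s₁) (by
      rw [e₁, e₂, smul_smul, smul_smul, ← add_smul, mul_comm, neg_mul, add_neg_cancel, zero_smul])
    rw [this.1, zero_smul] at e₂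
    exact hli.ne_zero 1 e₂
  · rw [hφ, smul_smul, mul_inv_cancel₀ hr0.ne', one_smul]

theorem circuit_mem_epiCone (hX : X.Nonempty) (hlam : lam ∈ normalizedCircuits A X) :
    ∃ β, lam ∈ sumZeroCone A β ∧ lam β = -1 ∧ SuppFinite A X lam ∧
      functionalForm A X lam ∈ epiCone A X β := by
  obtain ⟨β, ⟨h1, -, h2, -⟩, h3⟩ := hlam
  exact ⟨β, h1, h3, h2, functionalForm_mem_epiCone hX h1 h2⟩

/-- The circuit graph is finitely generated and contains the epigraph of the support function over
every `N_β`. -/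
theorem circuitGraph_fg (hX : X.Nonempty) (hpoly : IsPolyhedron X) (hind : ExpLinIndepOn A X) :
    (∃ T : Finset ((A → ℝ) × ℝ),
      (T : Set _) ⊆ functionalForm A X '' normalizedCircuits A X ∪ {(0, 1)} ∧
      PointedCone.hull ℝ (T : Set _) = circuitGraph A X) ∧
    ∀ β, epiCone A X β ≤ circuitGraph A X := by
  classical
  obtain ⟨v, hv, hvpos⟩ := exists_pos_functional hind
  have hS (β : A) : ∃ S : Finset ((A → ℝ) × ℝ), PointedCone.hull ℝ (S : Set _) = epiCone A X β ∧
      ∀ s ∈ S, GeneratesExtremeRay (epiCone A X β) s := by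
    obtain ⟨T, hT⟩ := epiCone_fg hpoly hX β
    have hT' : PointedCone.hull ℝ (T.erase 0 : Set _) = epiCone A X β := by
      rw [Finset.coe_erase]
      exact (Submodule.span_sdiff_singleton_zero (R := NNReal)).trans hT
    obtain ⟨S, -, h1, h2⟩ := exists_extreme_generators (T.erase 0)
      (logForm fun α => Real.log (v α)) fun t ht =>
        logForm_pos hX hv hvpos (by rw [← hT']; exact Submodule.subset_span ht)
          (Finset.ne_of_mem_erase ht)
    rw [hT'] at h1 h2
    exact ⟨S, h1, h2⟩
  choose S hSgen hSext using hS
  have hg : ∀ s ∈ Finset.univ.biUnion S,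
      ∃ q ∈ functionalForm A X '' normalizedCircuits A X ∪ {(0, 1)},
        s ∈ PointedCone.hull ℝ {q} := by
    intro s hs
    obtain ⟨β, -, hs⟩ := Finset.mem_biUnion.mp hs
    exact extreme_ray_epiCone hX (hSext β s hs)
  choose! g hgmem hghull using hg
  set T := insert (0, 1) ((Finset.univ.biUnion S).image g)
  have hTsub : (T : Set _) ⊆ functionalForm A X '' normalizedCircuits A X ∪ {(0, 1)} := by
    intro t ht
    rcases Finset.mem_insert.mp (Finset.mem_coe.mp ht) with rfl | ht
    · exact Or.inr rfl
    · obtain ⟨s, hs, rfl⟩ := Finset.mem_image.mp ht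
      exact hgmem s hs
  have hepi (β : A) : epiCone A X β ≤ PointedCone.hull ℝ (T : Set _) := by
    rw [← hSgen β, Submodule.span_le]
    intro s hs
    have hs' : s ∈ Finset.univ.biUnion S := Finset.mem_biUnion.mpr ⟨β, Finset.mem_univ _, hs⟩
    refine Submodule.span_mono ?_ (hghull s hs')
    rw [Set.singleton_subset_iff]
    exact Finset.mem_coe.mpr (Finset.mem_insert_of_mem (Finset.mem_image_of_mem _ hs'))
  have hTG : PointedCone.hull ℝ (T : Set _) = circuitGraph A X := by
    refine le_antisymm (Submodule.span_mono hTsub) (Submodule.span_le.mpr ?_)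
    rintro _ (⟨lam, hlam, rfl⟩ | rfl)
    · obtain ⟨β, -, -, -, h⟩ := circuit_mem_epiCone hX hlam
      exact hepi β h
    · exact Submodule.subset_span (Finset.mem_coe.mpr (Finset.mem_insert_self _ _))
  exact ⟨⟨T, hTsub, hTG⟩, fun β => hTG ▸ hepi β⟩

/-- A reduced circuit is indispensable in every family of circuits generating it. -/
theorem mem_of_reduced_of_mem_hull (hlam : lam ∈ reducedCircuits A X) {Φ : Set ((A → ℝ) × ℝ)}
    (hΦ : Φ ⊆ functionalForm A X '' normalizedCircuits A X ∪ {(0, 1)})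
    (h : functionalForm A X lam ∈ PointedCone.hull ℝ Φ) : functionalForm A X lam ∈ Φ := by
  obtain ⟨p, hp, r, hr, hpr⟩ := exists_mem_ray_of_mem_hull hlam.2
    (hΦ.trans Submodule.subset_span) h
  obtain ⟨β, ⟨hN, hlam0, -⟩, hβ⟩ := hlam.1
  rcases hΦ hp with ⟨μ, ⟨γ, ⟨hμN, -⟩, hγ⟩, rfl⟩ | rfl
  · have e : μ = r • lam := congrArg Prod.fst hpr
    have hγβ : β = γ := by
      by_contra hne
      have := hμN.1 β hne
      rw [e, Pi.smul_apply, hβ, smul_eq_mul] at this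
      linarith
    subst hγβ
    rw [e, Pi.smul_apply, hβ, smul_eq_mul] at hγ
    rw [show r = 1 by linarith, one_smul] at hpr
    rwa [hpr] at hp
  · have e : (0 : A → ℝ) = r • lam := congrArg Prod.fst hpr
    exact absurd ((smul_eq_zero.mp e.symm).resolve_left hr.ne') hlam0

theorem reducedCircuits_finite (hX : X.Nonempty) (hpoly : IsPolyhedron X)
    (hind : ExpLinIndepOn A X) : (reducedCircuits A X).Finite := by
  obtain ⟨T, hT, hgen⟩ := (circuitGraph_fg hX hpoly hind).1
  refine (T.finite_toSet.image Prod.fst).subset fun lam hlam => ?_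
  refine ⟨_, mem_of_reduced_of_mem_hull hlam hT ?_, rfl⟩
  rw [hgen]
  exact Submodule.subset_span (Or.inl ⟨lam, hlam.1, rfl⟩)

theorem circuitGraph_eq_hull_reduced (hX : X.Nonempty) (hpoly : IsPolyhedron X)
    (hind : ExpLinIndepOn A X) : circuitGraph A X =
      PointedCone.hull ℝ (functionalForm A X '' reducedCircuits A X ∪ {(0, 1)}) := by
  obtain ⟨v, hv, hvpos⟩ := exists_pos_functional hind
  obtain ⟨T, hT, hgen⟩ := (circuitGraph_fg hX hpoly hind).1
  obtain ⟨S, hST, hSgen, hSext⟩ := exists_extreme_generators T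
    (logForm fun α => Real.log (v α)) fun t ht => by
      rcases hT ht with ⟨lam, hlam, rfl⟩ | rfl
      · obtain ⟨β, -, hβ, -, h⟩ := circuit_mem_epiCone hX hlam
        refine logForm_pos hX hv hvpos h fun h0 => ?_
        have : lam = 0 := congrArg Prod.fst h0
        simp [this] at hβ
      · simp [logForm_apply]
  rw [hgen] at hSgen hSext
  refine le_antisymm ?_ (Submodule.span_mono (Set.union_subset_union_left _
    (Set.image_mono fun _ h => h.1)))
  rw [← hSgen]
  refine Submodule.span_mono fun s hs => ?_
  have hext := hSext s hs
  rcases hT (hST hs) with ⟨lam, hlam, rfl⟩ | rfl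
  · exact Or.inl ⟨lam, ⟨hlam, hext⟩, rfl⟩
  · exact Or.inr rfl

theorem reducedCircuits_nonempty (hX : X.Nonempty) (hpoly : IsPolyhedron X)
    (hind : ExpLinIndepOn A X) (hcirc : (normalizedCircuits A X).Nonempty) :
    (reducedCircuits A X).Nonempty := by
  by_contra h
  rw [Set.not_nonempty_iff_eq_empty] at h
  obtain ⟨lam, hlam⟩ := hcirc
  have hmem : functionalForm A X lam ∈ circuitGraph A X :=
    Submodule.subset_span (Or.inl ⟨lam, hlam, rfl⟩)
  rw [circuitGraph_eq_hull_reduced hX hpoly hind, h, Set.image_empty, Set.empty_union] at hmem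
  obtain ⟨r, -, hr⟩ := mem_hull_singleton.mp hmem
  obtain ⟨β, -, hβ⟩ := hlam
  have : lam = r • (0 : A → ℝ) := congrArg Prod.fst hr
  simp [this] at hβ

end Circuits

/-! ### Decomposition of the SAGE cone and irredundancy -/

section Decomposition

variable {n : ℕ} {A : Finset (Fin n → ℝ)} {X : Set (Fin n → ℝ)} {β : A} {lam : A → ℝ}

theorem witnessedCone_subset_sageCone (hX : X.Nonempty) (hlam : lam ∈ normalizedCircuits A X) :
    witnessedCone A X lam ⊆ sageCone A X := by
  obtain ⟨β, h1, h2, h3, -⟩ := circuit_mem_epiCone hX hlam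
  exact (witnessedCone_subset_ageCone hX h1 h2 h3).trans (ageCone_subset_sageCone β)

theorem ageCone_add {c d : A → ℝ} (hc : c ∈ ageCone A X β) (hd : d ∈ ageCone A X β) :
    c + d ∈ ageCone A X β :=
  ⟨fun α hα => add_nonneg (hc.1 α hα) (hd.1 α hα), fun x hx => by
    simpa [signomial, add_mul, Finset.sum_add_distrib] using add_nonneg (hc.2 x hx) (hd.2 x hx)⟩

theorem add_mem_finsetSum {ι E : Type*} [AddCommMonoid E] {s : Finset ι} {C : ι → Set E}
    (hC : ∀ i ∈ s, ∀ c ∈ C i, ∀ d ∈ C i, c + d ∈ C i) {c d : E} (hc : c ∈ ∑ i ∈ s, C i)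
    (hd : d ∈ ∑ i ∈ s, C i) : c + d ∈ ∑ i ∈ s, C i := by
  rw [Set.mem_finsetSum] at *
  obtain ⟨f, hf, rfl⟩ := hc
  obtain ⟨g, hg, rfl⟩ := hd
  exact ⟨f + g, fun {i} hi => hC i hi _ (hf hi) _ (hg hi), by simp [Finset.sum_add_distrib]⟩

theorem smul_mem_finsetSum {ι E : Type*} [AddCommGroup E] [Module ℝ E] {s : Finset ι}
    {C : ι → Set E} {r : ℝ} (hC : ∀ i ∈ s, ∀ c ∈ C i, r • c ∈ C i) {c : E}
    (hc : c ∈ ∑ i ∈ s, C i) : r • c ∈ ∑ i ∈ s, C i := by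
  rw [Set.mem_finsetSum] at *
  obtain ⟨f, hf, rfl⟩ := hc
  exact ⟨fun i => r • f i, fun {i} hi => hC i hi _ (hf hi), by simp [Finset.smul_sum]⟩

theorem mem_finsetSum_of_mem {ι E : Type*} [AddCommMonoid E] {s : Finset ι} {C : ι → Set E}
    (h0 : ∀ i ∈ s, (0 : E) ∈ C i) {i : ι} (hi : i ∈ s) {c : E} (hc : c ∈ C i) :
    c ∈ ∑ i ∈ s, C i := by
  classical
  rw [Set.mem_finsetSum]
  refine ⟨fun j => if j = i then c else 0, fun {j} hj => ?_, by simp [hi]⟩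
  by_cases h : j = i
  · subst h
    simpa using hc
  · simpa [h] using h0 j hj

theorem isClosed_sum_witnessedCone (hX : X.Nonempty) (hind : ExpLinIndepOn A X)
    {F : Finset (A → ℝ)} (hF : ∀ lam ∈ F, lam ∈ normalizedCircuits A X) :
    IsClosed (∑ lam ∈ F, witnessedCone A X lam) := by
  obtain ⟨Y, hYX, hY⟩ := exists_finset_separating hind
  let f : (A → ℝ) →ₗ[ℝ] (Y → ℝ) := LinearMap.pi fun y => Fintype.linearCombination ℝ (y : A → ℝ)
  have hf (c : A → ℝ) (y : Y) : f c y = ∑ α, c α * (y : A → ℝ) α := by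
    simp [f, Fintype.linearCombination_apply]
  refine isClosed_sum_of_nonneg f ?_ F _ (fun lam hlam => ?_) fun lam hlam c hc y => ?_
  · refine LinearMap.ker_eq_bot'.mpr fun c hc => hY c fun y hy => ?_
    rw [← hf c ⟨y, hy⟩, hc, Pi.zero_apply]
  · obtain ⟨β, h1, h2, -⟩ := circuit_mem_epiCone hX (hF lam hlam)
    exact isClosed_witnessedCone h1 h2
  · rw [hf]
    exact sum_mul_nonneg_of_mem_sageCone hYX
      (witnessedCone_subset_sageCone hX (hF lam hlam) hc) y.2

/-- A family of circuits generating the epigraphs of the support function witnesses every AGE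
cone. A positive vector `v` in the dual of the witnessed cones has a logarithm that is nonnegative
on the epigraphs; hence `log v` is dominated, relative to `β`, by an evaluation on `X`. -/
theorem ageCone_subset_sum_witnessedCone (hX : X.Nonempty) (hpoly : IsPolyhedron X)
    (hind : ExpLinIndepOn A X) {F : Finset (A → ℝ)} (hFne : F.Nonempty)
    (hF : ∀ lam ∈ F, lam ∈ normalizedCircuits A X)
    (hgen : epiCone A X β ≤ PointedCone.hull ℝ (functionalForm A X '' F ∪ {(0, 1)})) :
    ageCone A X β ⊆ ∑ lam ∈ F, witnessedCone A X lam := by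
  classical
  intro c hc
  by_contra hcK
  set K := ∑ lam ∈ F, witnessedCone A X lam
  have hN : ∀ lam ∈ F, ∃ β, lam ∈ sumZeroCone A β ∧ lam β = -1 := fun lam hlam => by
    obtain ⟨β, h1, h2, -⟩ := circuit_mem_epiCone hX (hF lam hlam)
    exact ⟨β, h1, h2⟩
  have hnn : ∀ lam ∈ F, ∀ d : A → ℝ, 0 ≤ d → d ∈ witnessedCone A X lam := fun lam hlam d hd => by
    obtain ⟨β, h1, h2⟩ := hN lam hlam
    exact nonneg_mem_witnessedCone h1 h2 hd
  have hK0 {lam d} (hlam : lam ∈ F) (hd : d ∈ witnessedCone A X lam) : d ∈ K :=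
    mem_finsetSum_of_mem (fun lam hlam => hnn lam hlam 0 le_rfl) hlam hd
  have hadd {d e} (hd : d ∈ K) (he : e ∈ K) : d + e ∈ K :=
    add_mem_finsetSum (fun lam hlam d hd e he => by
      obtain ⟨β, h1, h2⟩ := hN lam hlam
      exact witnessedCone_add h1 h2 hd he) hd he
  have hsmul {r : ℝ} (hr : 0 ≤ r) {d} (hd : d ∈ K) : r • d ∈ K :=
    smul_mem_finsetSum (fun lam hlam d hd => by
      obtain ⟨β, h1, h2⟩ := hN lam hlam
      exact witnessedCone_smul h1 h2 hd hr) hd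
  have hconv : Convex ℝ K := fun d hd e he a b ha hb _ => hadd (hsmul ha hd) (hsmul hb he)
  obtain ⟨f, u, hfK, hfc⟩ := geometric_hahn_banach_closed_point hconv
    (isClosed_sum_witnessedCone hX hind hF) hcK
  obtain ⟨lam₀, hlam₀⟩ := hFne
  have hu : 0 < u := by simpa using hfK 0 (hK0 hlam₀ (hnn _ hlam₀ 0 le_rfl))
  have hfK0 : ∀ d ∈ K, f d ≤ 0 := by
    intro d hd
    by_contra! hpos
    have := hfK _ (hsmul (div_pos hu hpos).le hd)
    rw [map_smul, smul_eq_mul, div_mul_cancel₀ _ hpos.ne'] at this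
    exact lt_irrefl _ this
  -- the separating functional as a nonnegative vector
  set v₁ : A → ℝ := fun α => -f (Pi.single α 1) with hv₁
  have hfv (d : A → ℝ) : ∑ α, d α * v₁ α = -f d := by
    conv_rhs => rw [← Finset.univ_sum_single d, map_sum, ← Finset.sum_neg_distrib]
    refine Finset.sum_congr rfl fun α _ => ?_
    have : (Pi.single α (d α) : A → ℝ) = d α • Pi.single α 1 := by
      rw [← Pi.single_smul, smul_eq_mul, mul_one]
    rw [this, map_smul, smul_eq_mul, hv₁, mul_neg]
  have hv₁0 (α : A) : 0 ≤ v₁ α :=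
    neg_nonneg.mpr (hfK0 _ (hK0 hlam₀ (hnn _ hlam₀ _ (Pi.single_nonneg.mpr zero_le_one))))
  -- a small multiple of a positive functional makes it positive
  obtain ⟨v₀, hv₀, hv₀pos⟩ := exists_pos_functional hind
  obtain ⟨ε, hε, hεc⟩ : ∃ ε : ℝ, 0 < ε ∧ ε * ∑ α, c α * v₀ α < f c := by
    have hfc0 := hu.trans hfc
    refine ⟨f c / (|∑ α, c α * v₀ α| + 1), by positivity, ?_⟩
    rw [div_mul_eq_mul_div, div_lt_iff₀ (by positivity)]
    exact mul_lt_mul_of_pos_left ((le_abs_self _).trans_lt (lt_add_one _)) hfc0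
  set v : A → ℝ := fun α => v₁ α + ε * v₀ α with hv
  have hvpos (α : A) : 0 < v α := add_pos_of_nonneg_of_pos (hv₁0 α) (mul_pos hε (hv₀ α))
  have hvsum (d : A → ℝ) : ∑ α, d α * v α = -f d + ε * ∑ α, d α * v₀ α := by
    rw [← hfv, Finset.mul_sum, ← Finset.sum_add_distrib]
    exact Finset.sum_congr rfl fun α _ => by rw [hv]; ring
  have hvc : ∑ α, c α * v α < 0 := by
    rw [hvsum]
    linarith
  have hvK : ∀ d ∈ K, d ∈ sageCone A X → 0 ≤ ∑ α, d α * v α := by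
    intro d hd hds
    rw [hvsum]
    by_cases hd0 : d = 0
    · simp [hd0]
    · exact add_nonneg (neg_nonneg.mpr (hfK0 d hd)) (mul_pos hε (hv₀pos d hds hd0)).le
  have hL : ∀ p ∈ epiCone A X β, 0 ≤ logForm (fun α => Real.log (v α)) p := by
    intro p hp
    refine nonneg_of_mem_hull _ ?_ (hgen hp)
    rintro _ (⟨lam, hlam, rfl⟩ | rfl)
    · obtain ⟨γ, h1, h2⟩ := hN lam hlam
      obtain ⟨d, hd, -, hde⟩ := exists_mem_witnessedCone (X := X) h1 h2 hvpos
      have := hvK d (hK0 hlam hd) (witnessedCone_subset_sageCone hX (hF lam hlam) hd)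
      rw [hde, sub_nonneg, Real.exp_le_one_iff] at this
      linarith
    · simp [logForm_apply]
  obtain ⟨x, hx, hxw⟩ := exists_mem_of_logForm_nonneg hpoly hL
  -- `v` dominates a multiple of the evaluation at `x`, with equality at `β`
  set t := v β / expMonomial β x with ht
  have ht0 : 0 < t := div_pos (hvpos β) (Real.exp_pos _)
  have hle (α : A) : t * expMonomial α x ≤ v α := by
    rw [ht, ← Real.exp_log (hvpos β), ← Real.exp_log (hvpos α), expMonomial, expMonomial,
      ← Real.exp_sub, ← Real.exp_add]
    refine Real.exp_le_exp.mpr ?_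
    have := hxw α
    linarith
  have hβe : t * expMonomial β x = v β := div_mul_cancel₀ _ (Real.exp_pos _).ne'
  have : 0 ≤ ∑ α, c α * v α := by
    refine (mul_nonneg ht0.le (hc.2 x hx)).trans ?_
    rw [signomial, Finset.mul_sum]
    refine Finset.sum_le_sum fun α _ => ?_
    rw [mul_left_comm]
    by_cases hα : α = β
    · rw [hα, hβe]
    · exact mul_le_mul_of_nonneg_left (hle α) (hc.1 α hα)
  linarith

/-- Without the reduced circuit `λ`, the witnessed cones do not generate the SAGE cone: `φ_λ` is
separated from the other generators of the circuit graph by the linear form of some `log v`, and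
then `v` is in the dual of all other witnessed cones, but negative somewhere on the one of `λ`. -/
theorem sageCone_ne_sum_of_notMem (hX : X.Nonempty) (hind : ExpLinIndepOn A X)
    {F : Finset (A → ℝ)} (hF : ∀ lam ∈ F, lam ∈ normalizedCircuits A X)
    (hlam : lam ∈ reducedCircuits A X) (hlamF : lam ∉ F) :
    sageCone A X ≠ ∑ μ ∈ F, witnessedCone A X μ := by
  classical
  intro heq
  set Φ : Finset ((A → ℝ) × ℝ) := insert (0, 1) (F.image (functionalForm A X))
  have hlam0 : functionalForm A X lam ∉ PointedCone.hull ℝ (Φ : Set _) := by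
    intro h
    have h1 := mem_of_reduced_of_mem_hull hlam (fun p hp => ?_) h
    · rcases Finset.mem_insert.mp (Finset.mem_coe.mp h1) with h2 | h2
      · obtain ⟨β, -, hβ⟩ := hlam.1
        have : lam = 0 := congrArg Prod.fst h2
        simp [this] at hβ
      · obtain ⟨μ, hμ, he⟩ := Finset.mem_image.mp h2
        have hμlam : μ = lam := congrArg Prod.fst he
        exact hlamF (hμlam ▸ hμ)
    · rcases Finset.mem_insert.mp (Finset.mem_coe.mp hp) with rfl | hp
      · exact Or.inr rfl
      · obtain ⟨μ, hμ, rfl⟩ := Finset.mem_image.mp hp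
        exact Or.inl ⟨μ, hF μ hμ, rfl⟩
  obtain ⟨f, hf, hneg⟩ := exists_separating_functional Φ _ hlam0
  obtain ⟨v₀, hv₀, hv₀pos⟩ := exists_pos_functional hind
  set g := logForm fun α => Real.log (v₀ α) with hg
  have hgpos {μ : A → ℝ} (hμ : μ ∈ normalizedCircuits A X) : 0 ≤ g (functionalForm A X μ) := by
    obtain ⟨γ, -, -, -, h⟩ := circuit_mem_epiCone hX hμ
    by_cases h0 : functionalForm A X μ = 0
    · rw [h0, map_zero]
    · exact (logForm_pos hX hv₀ hv₀pos h h0).le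
  -- a small multiple of `g` makes the last coefficient of `f` positive
  obtain ⟨ε, hε, hεneg⟩ : ∃ ε : ℝ, 0 < ε ∧
      f (functionalForm A X lam) + ε * g (functionalForm A X lam) < 0 := by
    have hg0 := hgpos hlam.1
    refine ⟨-f (functionalForm A X lam) / (g (functionalForm A X lam) + 1),
      div_pos (by linarith) (by linarith), ?_⟩
    have h1 : -f (functionalForm A X lam) / (g (functionalForm A X lam) + 1) *
        g (functionalForm A X lam) < -f (functionalForm A X lam) := by
      rw [div_mul_eq_mul_div, div_lt_iff₀ (by linarith)]
      exact mul_lt_mul_of_pos_left (lt_add_one _) (by linarith)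
    linarith
  set s := f (0, 1) + ε with hs
  have hs0 : 0 < s :=
    add_pos_of_nonneg_of_pos (hf _ (Finset.mem_insert_self _ _)) hε
  set v : A → ℝ := fun α => Real.exp (s⁻¹ * (f (Pi.single α 1, 0) + ε * Real.log (v₀ α))) with hv
  have hvL : logForm (fun α => Real.log (v α)) = s⁻¹ • (f + ε • g) := by
    have hg1 : g (0, 1) = 1 := by simp [hg, logForm_apply]
    ext α
    · simp [logForm_apply, hv, hg, Pi.single_apply]
      exact mul_add _ _ _
    · simp [logForm_apply, hg1]
      rw [← mul_add, ← hs, inv_mul_cancel₀ hs0.ne']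
  have hvpos (α : A) : 0 < v α := Real.exp_pos _
  obtain ⟨β, h1, h2, h3, -⟩ := circuit_mem_epiCone hX hlam.1
  obtain ⟨c, hc, -, hce⟩ := exists_mem_witnessedCone (X := X) h1 h2 hvpos
  have hcneg : ∑ α, c α * v α < 0 := by
    rw [hce, sub_neg, Real.one_lt_exp_iff, neg_pos, hvL]
    exact mul_neg_of_pos_of_neg (inv_pos.mpr hs0) hεneg
  have hcK := witnessedCone_subset_sageCone hX hlam.1 hc
  rw [heq, Set.mem_finsetSum] at hcK
  obtain ⟨d, hd, rfl⟩ := hcK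
  refine absurd hcneg (not_lt.mpr ?_)
  simp only [Finset.sum_apply, Finset.sum_mul]
  rw [Finset.sum_comm]
  refine Finset.sum_nonneg fun μ hμ => ?_
  obtain ⟨γ, h1, h2, -⟩ := circuit_mem_epiCone hX (hF μ hμ)
  refine pairing_nonneg h1 h2 hvpos ?_ (hd hμ)
  rw [hvL]
  exact mul_nonneg (inv_nonneg.mpr hs0.le) (add_nonneg
    (hf _ (Finset.mem_insert_of_mem (Finset.mem_image_of_mem _ hμ)))
    (mul_nonneg hε.le (hgpos (hF μ hμ))))

end Decomposition

end ConditionalSAGE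

theorem theorem5p4 {n : ℕ} (A : Finset (Fin n → ℝ)) (hA : A.Nonempty)
    (X : Set (Fin n → ℝ)) (hXne : X.Nonempty) (hX : ConditionalSAGE.IsPolyhedron X)
    (hind : ConditionalSAGE.ExpLinIndepOn A X)
    (hcirc : (ConditionalSAGE.normalizedCircuits A X).Nonempty) :
    ∃ hfin : (ConditionalSAGE.reducedCircuits A X).Finite,
      ConditionalSAGE.sageCone A X =
          ∑ lam ∈ hfin.toFinset, ConditionalSAGE.witnessedCone A X lam ∧
        ∀ L : Finset (A → ℝ), L ⊂ hfin.toFinset →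
          ConditionalSAGE.sageCone A X ≠ ∑ lam ∈ L, ConditionalSAGE.witnessedCone A X lam := by
  open ConditionalSAGE in
  have hfin := reducedCircuits_finite hXne hX hind
  have hF : ∀ lam ∈ hfin.toFinset, lam ∈ normalizedCircuits A X := fun lam hlam =>
    (hfin.mem_toFinset.mp hlam).1
  have hFne : hfin.toFinset.Nonempty :=
    hfin.toFinset_nonempty.mpr (reducedCircuits_nonempty hXne hX hind hcirc)
  have hN : ∀ lam ∈ hfin.toFinset, ∃ β, lam ∈ sumZeroCone A β ∧ lam β = -1 := fun lam hlam => by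
    obtain ⟨β, h1, h2, -⟩ := circuit_mem_epiCone hXne (hF lam hlam)
    exact ⟨β, h1, h2⟩
  refine ⟨hfin, Set.Subset.antisymm ?_ ?_, fun L hL => ?_⟩
  · intro c hc
    rw [sageCone, Set.mem_finsetSum] at hc
    obtain ⟨g, hg, rfl⟩ := hc
    refine Finset.sum_induction _ (· ∈ ∑ lam ∈ hfin.toFinset, witnessedCone A X lam)
      (fun c d hc hd => add_mem_finsetSum (fun lam hlam c hc d hd => ?_) hc hd) ?_ fun β hβ => ?_
    · obtain ⟨β, h1, h2⟩ := hN lam hlam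
      exact witnessedCone_add h1 h2 hc hd
    · obtain ⟨lam, hlam⟩ := hFne
      refine mem_finsetSum_of_mem (fun lam hlam => ?_) hlam ?_
      all_goals
        obtain ⟨β, h1, h2⟩ := hN _ hlam
        exact nonneg_mem_witnessedCone h1 h2 le_rfl
    · refine ageCone_subset_sum_witnessedCone hXne hX hind hFne hF ?_ (hg hβ)
      rw [hfin.coe_toFinset, ← circuitGraph_eq_hull_reduced hXne hX hind]
      exact (circuitGraph_fg hXne hX hind).2 β
  · intro c hc
    rw [Set.mem_finsetSum] at hc
    obtain ⟨g, hg, rfl⟩ := hc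
    exact Finset.sum_induction _ (· ∈ sageCone A X)
      (fun c d hc hd => add_mem_finsetSum (fun β _ c hc d hd => ageCone_add hc hd) hc hd)
      (ageCone_subset_sageCone ⟨_, hA.choose_spec⟩
        ⟨fun _ _ => le_rfl, fun x _ => by simp [signomial]⟩)
      fun lam hlam => witnessedCone_subset_sageCone hXne (hF lam hlam) (hg hlam)
  · obtain ⟨lam, hlam, hlamL⟩ := Finset.exists_of_ssubset hL
    exact sageCone_ne_sum_of_notMem hXne hind (fun μ hμ => hF μ (hL.1 hμ))
      (hfin.mem_toFinset.mp hlam) hlamL
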